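/- Let $\mathbb M=\mathbb R^2$ be Minkowski space with coordinates $x=(x^0,x^1)$, put $x^2=(x^0)^2-(x^1)^2$, and for $z=x-y$ write $u=z^0+z^1$, $v=z^0-z^1$, $\partial_u=\frac12(\partial_0+\partial_1)$, $\partial_v=\frac12(\partial_0-\partial_1)$. Elements of the doubled field algebra are normal ordered functionals ${:}F{:}$ of pairs $(\phi,\tilde\phi)$ of smooth real functions on $\mathbb M$, where ${:}F{:}$ and ${:}G{:}$ are identified if $F=G$ on all pairs with $\partial_u\tilde\phi=\partial_u\phi$, $\partial_v\tilde\phi=-\partial_v\phi$. Moreover ${:}F{:}^*={:}\overline F{:}$, and ${:}F{:}\star{:}G{:}={:}F\star_1G{:}$ with $$(F\star_1G)[\phi]=\sum_n\tfrac1{n!}\big\langle F^{(n)}[\phi],W^{\otimes n}G^{(n)}[\phi]\big\rangle ,\qquad W=\begin{pmatrix}\frac i2\Delta+H&-\frac i2\tilde\Delta^{T}+\tilde H\\ \frac i2\tilde\Delta+\tilde H&\frac i2\Delta+H\end{pmatrix}.$$ Here $\Delta=-\frac12\Theta(z^0-|z^1|)+\frac12\Theta(-z^0-|z^1|)$, $\tilde\Delta(x,y)=\frac12(\Theta(-u)+\Theta(v))$,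 $\tilde\Delta^T(x,y)=\tilde\Delta(y,x)$, $H=-\frac1{4\pi}\ln|uv|$, $\tilde H=-\frac1{4\pi}\ln|u/v|$. The product is understood as the limit $\varepsilon\downarrow0$ of the products with the smooth kernels $W_\varepsilon$ in which $\frac i2\Delta+H$ is replaced by $-\frac1{4\pi}\big(\ln(iu+\varepsilon)+\ln(iv+\varepsilon)\big)$ and the lower left (upper right) entry by $-\frac1{4\pi}\big(\ln(iu+\varepsilon)-\ln(iv+\varepsilon)\big)\pm\frac i4$ (with $+$ for the lower left and $-$ for the upper right entry); $W_\varepsilon\to W$ off the light cone. Let $\Phi,\tilde\Phi$ denote the field functionals. For $\alpha>0$ put $$\psi_+=-i(2\pi)^{-1/2}\,{:}e^{i(\alpha\Phi+\frac\pi\alpha\tilde\Phi)}{:},\qquad \psi_-=(2\pi)^{-1/2}\,{:}e^{i(-\alpha\Phi+\frac\pi\alpha\tilde\Phi)}{:}.$$ Then the following hold. 1. For every $\alpha>0$ the fields $\psi_+,\psi_-,\psi_+^*,\psi_-^*$ anticommute (with themselves and with each other) at spacelike separation, both at points and smeared with test functions of spacelike separated supports. 2. For $\alpha=\sqrt\pi$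 they are free chiral Fermi fields: as distributions on $\mathbb M\times\mathbb M$, $\{\psi_a(x),\psi_b(y)\}=0=\{\psi_a^*(x),\psi_b^*(y)\}$ for $a,b\in\{+,-\}$, $\{\psi_+^*(x),\psi_-(y)\}=0=\{\psi_-^*(x),\psi_+(y)\}$, $\{\psi_+^*(x),\psi_+(y)\}=\delta(u)$, $\{\psi_-^*(x),\psi_-(y)\}=\delta(v)$; moreover $\partial_v\psi_+=0$ and $\partial_u\psi_-=0$. 3. For every $\alpha>0$ (products of fields at one point being normal ordered) $$\partial_v\psi_+=i\big(\alpha-\tfrac\pi\alpha\big)(\partial_v\Phi)\psi_+,\qquad \partial_u\psi_-=-i\big(\alpha-\tfrac\pi\alpha\big)(\partial_u\Phi)\psi_- .$$ Put $\kappa'=\frac{(\alpha-\pi/\alpha)^2}{4\pi}$. For $y\to x$ within closed spacelike cones there are expansions $$|(x-y)^2|^{\kappa'}\psi_+^*(x)\star\psi_+(y)=\tfrac1{2\pi iu}+N(\psi_+^*\psi_+)(x)+\tfrac vu B_+(x)+o(1),$$ $$|(x-y)^2|^{\kappa'}\psi_-^*(x)\star\psi_-(y)=\tfrac1{2\pi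 iv}+N(\psi_-^*\psi_-)(x)+\tfrac uv B_-(x)+o(1),$$ which define the normal products as the coefficients independent of the direction of approach, and $$N(\psi_+^*\psi_+)=-\big(\tfrac\alpha{2\pi}+\tfrac1{2\alpha}\big)\partial_u\Phi,\qquad N(\psi_-^*\psi_-)=\big(\tfrac\alpha{2\pi}+\tfrac1{2\alpha}\big)\partial_v\Phi .$$ There is $Z>0$ such that, with $j_u=Z\,N(\psi_+^*\psi_+)$ and $j_v=Z\,N(\psi_-^*\psi_-)$, the fields $\psi_\pm$ have charge $-1$ with respect to the charge density $j_u+j_v$, i.e. $\int dx^1\,[(j_u+j_v)(x),\psi_\pm(y)]_\star=-\psi_\pm(y)$. For this normalization $j_u=-\frac\alpha\pi\partial_u\Phi$, $j_v=\frac\alpha\pi\partial_v\Phi$, and $\psi=\binom{\psi_+}{\psi_-}$ satisfies the massless Thirring field equation $$\gamma^\mu\big(i\partial_\mu-g\,(\overline\psi\gamma_\mu\psi)\big)\psi=0,\qquad g=\frac{\pi^2}{\alpha^2}-\pi,$$ where $\gamma^0=\begin{pmatrix}0&1\\1&0\end{pmatrix}$, $\gamma^1=\begin{pmatrix}0&1\\-1&0\end{pmatrix}$,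 $\overline\psi=(\psi_+^*,\psi_-^*)\gamma^0$, and $\psi_+^*\psi_+$, $\psi_-^*\psi_-$ in the current are replaced by $j_u$, $j_v$; equivalently $i\partial_u\psi_-=g\,j_u\psi_-$ and $i\partial_v\psi_+=g\,j_v\psi_+$. 4. For every $\beta>0$, with $\alpha=\beta/2$, $${:}\cos\beta\Phi(x){:}=\pi\,N(\overline\psi\psi)(x),\qquad N(\overline\psi\psi)(x)=\lim_{y\to x}|(x-y)^2|^{-\left(\frac{\alpha^2}{4\pi}-\frac\pi{4\alpha^2}\right)}\big(\psi_-^*(x)\star\psi_+(y)+\psi_+^*(x)\star\psi_-(y)\big),$$ the limit being taken through points $y$ spacelike to $x$. -/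

import Mathlib

open Filter Topology MeasureTheory
open scoped ContDiff Matrix

noncomputable section

namespace Thirring

/-- Two-dimensional Minkowski space with coordinates `(x⁰, x¹)`. -/
abbrev Spacetime : Type := ℝ × ℝ

/-- The lightcone coordinate `u = x⁰ + x¹`. -/
def lcU (z : Spacetime) : ℝ := z.1 + z.2

/-- The lightcone coordinate `v = x⁰ - x¹`. -/
def lcV (z : Spacetime) : ℝ := z.1 - z.2

/-- The Lorentz square `z² = (z⁰)² - (z¹)² = u v`. -/
def lorentzSq (z : Spacetime) : ℝ := lcU z * lcV z

/-- The point with lightcone coordinates `(u, v)`. -/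
def ofLightcone (u v : ℝ) : Spacetime := ((u + v) / 2, (u - v) / 2)

/-- The tangent vector of `∂_u = (∂₀ + ∂₁) / 2`. -/
def dirU : Spacetime := (1 / 2, 1 / 2)

/-- The tangent vector of `∂_v = (∂₀ - ∂₁) / 2`. -/
def dirV : Spacetime := (1 / 2, -1 / 2)

/-- `x` and `y` are spacelike separated. -/
def Spacelike (x y : Spacetime) : Prop := lorentzSq (x - y) < 0

/-! ### The doubled configuration space and its functionals -/

/-- The doubled configuration space: pairs of smooth real functions `(φ, φ̃)` on Minkowski space;
component `0` is `φ`, component `1` is the dual configuration `φ̃`. -/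
def Config : Submodule ℝ (Fin 2 → Spacetime → ℝ) where
  carrier := {φ | ∀ i, ContDiff ℝ ∞ (φ i)}
  add_mem' := fun ha hb i => (ha i).add (hb i)
  zero_mem' := fun _ => contDiff_const
  smul_mem' := fun c _ ha i => (ha i).const_smul c

/-- Functionals on the doubled configuration space. An element `:F:` of the (enlarged) field
algebra is represented by its symbol `F`, i.e. the linear isomorphism `F ↦ :F:` is used as an
identification; the pointwise product of symbols is then the normal ordered product, the complex
conjugate of `F` represents `:F:*`, and the product `⋆` of the field algebra is
`:F: ⋆ :G: = :F ⋆₁ G:`, see `IsStarProduct`. -/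
abbrev Functional : Type := Config → ℂ

/-- The pairs with `∂_u φ̃ = ∂_u φ`, `∂_v φ̃ = -∂_v φ` (these automatically solve the wave equation).
Two elements of the field algebra are identified if their symbols agree on all such pairs. -/
def OnShell (φ : Config) : Prop :=
  ∀ x, fderiv ℝ (φ.1 1) x dirU = fderiv ℝ (φ.1 0) x dirU ∧
    fderiv ℝ (φ.1 1) x dirV = -fderiv ℝ (φ.1 0) x dirV

/-- The functional derivatives `F⁽ⁿ⁾[φ]` of a functional as compactly supported distributions in
`n` points. `D n φ I T` is the value on the smooth function `T` of `n` points of the component in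
which the `k`-th derivative is taken with respect to the field `I k`. -/
structure FunctionalDerivatives (F : Functional) where
  D : (n : ℕ) → Config → (Fin n → Fin 2) → ((Fin n → Spacetime) → ℂ) → ℂ
  map_add : ∀ n φ I T T', ContDiff ℝ ∞ T → ContDiff ℝ ∞ T' →
    D n φ I (fun x => T x + T' x) = D n φ I T + D n φ I T'
  map_smul : ∀ n φ I (c : ℂ) T, ContDiff ℝ ∞ T → D n φ I (fun x => c * T x) = c * D n φ I T
  /-- continuity and compact support -/
  bound : ∀ n φ I, ∃ (k : ℕ) (R C : ℝ), ∀ T, ContDiff ℝ ∞ T → ∀ B : ℝ,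
    (∀ j ≤ k, ∀ x, ‖x‖ ≤ R → ‖iteratedFDeriv ℝ j T x‖ ≤ B) → ‖D n φ I T‖ ≤ C * B
  zeroth : ∀ φ I T, D 0 φ I T = F φ * T Fin.elim0
  /-- `F⁽ⁿ⁺¹⁾` is the derivative of `F⁽ⁿ⁾` in every direction `h` of the configuration space -/
  succ : ∀ n φ I T, ContDiff ℝ ∞ T → ∀ h : Config,
    HasDerivAt (fun t : ℝ => D n (φ + t • h) I T)
      (∑ i, D (n + 1) φ (Fin.cons i I) (fun x => (h.1 i (x 0) : ℂ) * T (Fin.tail x))) 0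

/-! ### Commutator functions, Hadamard functions and the star product

All two-point functions are written as functions of the difference variable `z = x - y`. -/

/-- The Heaviside function. -/
def heaviside (s : ℝ) : ℝ := if 0 < s then 1 else 0

/-- The commutator function `Δ` of the massless scalar field. -/
def comm (z : Spacetime) : ℝ :=
  -(1 / 2) * heaviside (z.1 - |z.2|) + 1 / 2 * heaviside (-z.1 - |z.2|)

/-- The function `Δ̃ = (Θ(-u) + Θ(v)) / 2`. -/
def dualComm (z : Spacetime) : ℝ := 1 / 2 * (heaviside (-lcU z) + heaviside (lcV z))

/-- `H = -(1/4π) ln |z²|` (mass scale `1`). -/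
def hadamard (z : Spacetime) : ℝ := -(1 / (4 * Real.pi)) * Real.log |lorentzSq z|

/-- `H̃ = -(1/4π) ln |u/v|`. -/
def dualHadamard (z : Spacetime) : ℝ := -(1 / (4 * Real.pi)) * Real.log |lcU z / lcV z|

/-- The matrix of two-point functions of the Wick star product `⋆₁`: the Weyl-Moyal part, given by
`Φ⋆Φ - ΦΦ = Φ̃⋆Φ̃ - Φ̃Φ̃ = (i/2) Δ(x,y)`, `Φ̃(x)⋆Φ(y) - Φ̃(x)Φ(y) = (i/2) Δ̃(x,y)`,
`Φ(x)⋆Φ̃(y) - Φ(x)Φ̃(y) = -(i/2) Δ̃(y,x)`, plus the symmetric part with entries `H`, `H̃`. -/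
def twoPoint (i j : Fin 2) (z : Spacetime) : ℂ :=
  !![Complex.I / 2 * comm z + hadamard z, -(Complex.I / 2) * dualComm (-z) + dualHadamard z;
     Complex.I / 2 * dualComm z + dualHadamard z, Complex.I / 2 * comm z + hadamard z] i j

/-- The `iε`-regularization of `twoPoint`, a smooth function for `ε > 0`. -/
def twoPointReg (ε : ℝ) (i j : Fin 2) (z : Spacetime) : ℂ :=
  let L : ℂ := Complex.log (Complex.I * lcU z + ε)
  let R : ℂ := Complex.log (Complex.I * lcV z + ε)
  let k : ℂ := -(1 / (4 * Real.pi))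
  !![k * (L + R), k * (L - R) - Complex.I / 4;
     k * (L - R) + Complex.I / 4, k * (L + R)] i j

/-- Off the light cone, the boundary value of `twoPointReg` is `twoPoint`. -/
theorem tendsto_twoPointReg (i j : Fin 2) (z : Spacetime) (hu : lcU z ≠ 0) (hv : lcV z ≠ 0) :
    Tendsto (fun ε : ℝ => twoPointReg ε i j z) (𝓝[>] 0) (𝓝 (twoPoint i j z)) := by
  have key : ∀ s : ℝ, s ≠ 0 → Tendsto (fun ε : ℝ => Complex.log (Complex.I * s + ε)) (𝓝[>] 0)
      (𝓝 (Real.log |s| + (if 0 < s then 1 else -1) * (Real.pi / 2) * Complex.I)) := by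
    intro s hs
    have h1 : Complex.log (Complex.I * s) =
        Real.log |s| + (if 0 < s then 1 else -1) * (Real.pi / 2) * Complex.I := by
      rcases lt_or_gt_of_ne hs with h | h
      · have e : Complex.I * (s : ℂ) = ((-s : ℝ) : ℂ) * (-Complex.I) := by push_cast; ring
        rw [e, Complex.log_ofReal_mul (by linarith) (by simp), Complex.log_neg_I, abs_of_neg h,
          if_neg (not_lt.mpr h.le)]
        ring
      · rw [mul_comm, Complex.log_ofReal_mul h (by simp), Complex.log_I, abs_of_pos h, if_pos h]
        ring
    rw [← h1]
    have hc : ContinuousAt (fun ε : ℝ => Complex.log (Complex.I * s + ε)) 0 := by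
      refine ContinuousAt.clog (by fun_prop) ?_
      right
      simpa using hs
    have := hc.tendsto
    simp only [Complex.ofReal_zero, add_zero] at this
    exact this.mono_left nhdsWithin_le_nhds
  have hL := key _ hu
  have hR := key _ hv
  have hpi : (Real.pi : ℂ) ≠ 0 := by exact_mod_cast Real.pi_ne_zero
  have habs : Real.log |lorentzSq z| = Real.log |lcU z| + Real.log |lcV z| := by
    rw [lorentzSq, abs_mul, Real.log_mul (abs_ne_zero.mpr hu) (abs_ne_zero.mpr hv)]
  have hdiv : Real.log |lcU z / lcV z| = Real.log |lcU z| - Real.log |lcV z| := by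
    rw [abs_div, Real.log_div (abs_ne_zero.mpr hu) (abs_ne_zero.mpr hv)]
  have hcomm : comm z = -(1 / 4) * ((if 0 < lcU z then 1 else -1) + if 0 < lcV z then 1 else -1) := by
    unfold comm heaviside
    unfold lcU at *
    unfold lcV at *
    rcases abs_cases z.2 with ⟨h, _⟩ | ⟨h, _⟩ <;> rw [h] <;>
      rcases lt_or_gt_of_ne hu with h1 | h1 <;> rcases lt_or_gt_of_ne hv with h2 | h2 <;>
      split_ifs <;> first | (exfalso; linarith) | norm_num
  have hneg1 : lcU (-z) = -lcU z := by simp [lcU]; ring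
  have hneg2 : lcV (-z) = -lcV z := by simp [lcV]; ring
  have hd1 : dualComm z = 1 / 2 + 1 / 4 * ((if 0 < lcV z then 1 else -1) - if 0 < lcU z then 1 else -1) := by
    unfold dualComm heaviside
    rcases lt_or_gt_of_ne hu with h1 | h1 <;> rcases lt_or_gt_of_ne hv with h2 | h2 <;>
      simp [h1, h2, not_lt.mpr h1.le, not_lt.mpr h2.le] <;> norm_num
  have hd2 : dualComm (-z) = 1 / 2 - 1 / 4 * ((if 0 < lcV z then 1 else -1) - if 0 < lcU z then 1 else -1) := by
    unfold dualComm heaviside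
    rw [hneg1, hneg2]
    rcases lt_or_gt_of_ne hu with h1 | h1 <;> rcases lt_or_gt_of_ne hv with h2 | h2 <;>
      simp [h1, h2, not_lt.mpr h1.le, not_lt.mpr h2.le] <;> norm_num
  have hp := (hL.add hR).const_mul (-(1 / (4 * (Real.pi : ℂ))))
  have hm := (hL.sub hR).const_mul (-(1 / (4 * (Real.pi : ℂ))))
  have e1 : -(1 / (4 * (Real.pi : ℂ))) *
      ((Real.log |lcU z| + (if 0 < lcU z then 1 else -1) * (Real.pi / 2) * Complex.I) +
        (Real.log |lcV z| + (if 0 < lcV z then 1 else -1) * (Real.pi / 2) * Complex.I)) =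
      Complex.I / 2 * comm z + hadamard z := by
    rw [hcomm, hadamard, habs]
    push_cast
    field_simp
    split_ifs <;> push_cast <;> ring
  have e2 : -(1 / (4 * (Real.pi : ℂ))) *
      ((Real.log |lcU z| + (if 0 < lcU z then 1 else -1) * (Real.pi / 2) * Complex.I) -
        (Real.log |lcV z| + (if 0 < lcV z then 1 else -1) * (Real.pi / 2) * Complex.I)) -
        Complex.I / 4 = -(Complex.I / 2) * dualComm (-z) + dualHadamard z := by
    rw [hd2, dualHadamard, hdiv]
    push_cast
    field_simp
    split_ifs <;> push_cast <;> ring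
  have e3 : -(1 / (4 * (Real.pi : ℂ))) *
      ((Real.log |lcU z| + (if 0 < lcU z then 1 else -1) * (Real.pi / 2) * Complex.I) -
        (Real.log |lcV z| + (if 0 < lcV z then 1 else -1) * (Real.pi / 2) * Complex.I)) +
        Complex.I / 4 = Complex.I / 2 * dualComm z + dualHadamard z := by
    rw [hd1, dualHadamard, hdiv]
    push_cast
    field_simp
    split_ifs <;> push_cast <;> ring
  have t2 := hm.sub_const (Complex.I / 4)
  have t3 := hm.add_const (Complex.I / 4)
  rw [e1] at hp
  rw [e2] at t2
  rw [e3] at t3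
  fin_cases i <;> fin_cases j
  · exact hp
  · exact t2
  · exact t3
  · exact hp

/-- `K = F ⋆₁ G`, where
`(F ⋆₁ G)[φ] = ∑ₙ (1/n!) ⟨F⁽ⁿ⁾[φ], W^{⊗n} G⁽ⁿ⁾[φ]⟩` with `W = twoPoint` understood as the
distributional boundary value, as `ε ↓ 0`, of the smooth kernels `twoPointReg ε`. -/
def IsStarProduct (F G K : Functional) : Prop :=
  ∃ (DF : FunctionalDerivatives F) (DG : FunctionalDerivatives G),
    ∀ φ : Config, ∃ S : ℝ → ℂ,
      (∀ ε : ℝ, 0 < ε →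
        HasSum (fun n : ℕ => (n.factorial : ℂ)⁻¹ * ∑ I : Fin n → Fin 2, ∑ J : Fin n → Fin 2,
          DF.D n φ I (fun x => DG.D n φ J
            (fun y => ∏ k, twoPointReg ε (I k) (J k) (x k - y k)))) (S ε)) ∧
      Tendsto S (𝓝[>] 0) (𝓝 (K φ))

/-- `F ⋆ G + G ⋆ F = C` in the field algebra (i.e. modulo symbols vanishing on shell). -/
def IsAnticommutator (F G C : Functional) : Prop :=
  ∃ K L : Functional, IsStarProduct F G K ∧ IsStarProduct G F L ∧
    ∀ φ, OnShell φ → K φ + L φ = C φ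

/-- `F ⋆ G - G ⋆ F = C` in the field algebra. -/
def IsCommutator (F G C : Functional) : Prop :=
  ∃ K L : Functional, IsStarProduct F G K ∧ IsStarProduct G F L ∧
    ∀ φ, OnShell φ → K φ - L φ = C φ

/-! ### Fields -/

/-- Test functions on Minkowski space. -/
def IsTest (f : Spacetime → ℂ) : Prop := ContDiff ℝ ∞ f ∧ HasCompactSupport f

/-- The smeared field `A(f) = ∫ f(x) A(x) dx`. -/
def smear (A : Spacetime → Functional) (f : Spacetime → ℂ) : Functional :=
  fun φ => ∫ x, f x * A x φ

/-- The adjoint field. -/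
def adj (A : Spacetime → Functional) : Spacetime → Functional :=
  fun x φ => (starRingEnd ℂ) (A x φ)

/-- The symbol of the vertex operator `:exp(i(a Φ(x) + b Φ̃(x))):`, with `c = (a, b)`. -/
def vertex (c : Fin 2 → ℝ) (x : Spacetime) : Functional :=
  fun φ => Complex.exp (Complex.I * ∑ i, (c i : ℂ) * (φ.1 i x : ℂ))

/-- The fields `ψ₊` (index `0`) and `ψ₋` (index `1`):
`ψ₊ = -i (2π)^{-1/2} :exp(i(αΦ + (π/α)Φ̃)):`, `ψ₋ = (2π)^{-1/2} :exp(i(-αΦ + (π/α)Φ̃)):`. -/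
def fermi (α : ℝ) : Fin 2 → Spacetime → Functional :=
  ![fun x φ => -Complex.I * ((Real.sqrt (2 * Real.pi))⁻¹ : ℝ) * vertex ![α, Real.pi / α] x φ,
    fun x φ => ((Real.sqrt (2 * Real.pi))⁻¹ : ℝ) * vertex ![-α, Real.pi / α] x φ]

/-- The adjoints `ψ₊*`, `ψ₋*`. -/
def fermiAdj (α : ℝ) (a : Fin 2) : Spacetime → Functional := adj (fermi α a)

/-- The lightcone derivatives `∂_u Φ(x)` (index `0`) and `∂_v Φ(x)` (index `1`) of the field. -/
def dPhi : Fin 2 → Spacetime → Functional :=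
  ![fun x φ => (fderiv ℝ (φ.1 0) x dirU : ℂ), fun x φ => (fderiv ℝ (φ.1 0) x dirV : ℂ)]

/-- The distributions `δ(u)` (index `0`) and `δ(v)` (index `1`), with `(u, v)` the lightcone
coordinates of `x - y`, smeared with `f(x) g(y)`; note `dx = du dv / 2`. -/
def deltaLC (a : Fin 2) (f g : Spacetime → ℂ) : ℂ :=
  ![∫ s : ℝ, (1 / 2 * ∫ t : ℝ, f (ofLightcone s t)) * (1 / 2 * ∫ t : ℝ, g (ofLightcone s t)),
    ∫ s : ℝ, (1 / 2 * ∫ t : ℝ, f (ofLightcone t s)) * (1 / 2 * ∫ t : ℝ, g (ofLightcone t s))] a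

/-- `A` and `B` anticommute at spacelike separation, at points as well as smeared. -/
def AnticommuteSpacelike (A B : Spacetime → Functional) : Prop :=
  (∀ x y, Spacelike x y → IsAnticommutator (A x) (B y) 0) ∧
  ∀ f g, IsTest f → IsTest g → (∀ x ∈ tsupport f, ∀ y ∈ tsupport g, Spacelike x y) →
    IsAnticommutator (smear A f) (smear B g) 0

/-! ### Dirac matrices, normal products, currents -/

/-- The Dirac matrices `γ⁰`, `γ¹`. -/
def gamma : Fin 2 → Matrix (Fin 2) (Fin 2) ℂ :=
  ![!![0, 1; 1, 0], !![0, 1; -1, 0]]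

/-- `γ_μ`, the index being lowered with the metric `diag(1, -1)`. -/
def gammaLow : Fin 2 → Matrix (Fin 2) (Fin 2) ℂ := ![gamma 0, -gamma 1]

/-- The points `y` such that `y - x` lies in a closed spacelike cone, with the apex removed; every
closed spacelike cone is contained in one of these for sufficiently large `r`. -/
def cone (x : Spacetime) (r : ℝ) : Set Spacetime :=
  {y | Spacelike x y ∧ |lcU (x - y)| ≤ r * |lcV (x - y)| ∧ |lcV (x - y)| ≤ r * |lcU (x - y)|}

/-- `N` is the normal product `N(ψₐ* ψₐ)`. With `w = u`, `w' = v` for `a = +` and `w = v`, `w' = u`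
for `a = -`, where `(u, v)` are the lightcone coordinates of `x - y`, there is an expansion
`|(x-y)²|^κ ψₐ*(x) ⋆ ψₐ(y) = (2π i w)⁻¹ + N(x) + (w'/w) B(x) + o(1)`, `κ = (α - π/α)² / 4π`,
as `y → x` in closed spacelike cones, and `N(x)` is the coefficient which does not depend on the
direction from which `x` is approached. -/
def IsNormalDensity (α : ℝ) (a : Fin 2) (N : Spacetime → Functional) : Prop :=
  ∀ x, ∃ P : Spacetime → Functional,
    (∀ y, Spacelike x y → IsStarProduct (fermiAdj α a x) (fermi α a y) (P y)) ∧
    ∃ B : Functional, ∀ φ, OnShell φ → ∀ r : ℝ,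
      Tendsto (fun y =>
          ((|lorentzSq (x - y)| ^ ((α - Real.pi / α) ^ 2 / (4 * Real.pi)) : ℝ) : ℂ) * P y φ
            - (2 * Real.pi * Complex.I * (![lcU (x - y), lcV (x - y)] a : ℝ))⁻¹
            - ((![lcV (x - y) / lcU (x - y), lcU (x - y) / lcV (x - y)] a : ℝ) : ℂ) * B φ)
        (𝓝[cone x r] x) (𝓝 (N x φ))

/-- The field `A` has charge `q` with respect to the charge density `ρ`, i.e.
`∫ dx¹ [ρ(t, x¹), A(y)] = q A(y)`. The charge is represented by smearing `ρ` with `τ(x⁰) χ(x¹)`,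
`∫ τ = 1`, where the spatial cutoff `χ` is `1` on the causal influence region of `y`. -/
def HasCharge (ρ A : Spacetime → Functional) (q : ℂ) : Prop :=
  ∀ (y : Spacetime) (τ χ : ℝ → ℝ), ContDiff ℝ ∞ τ → HasCompactSupport τ →
    ContDiff ℝ ∞ χ → HasCompactSupport χ → (∫ t, τ t = 1) →
    (∀ t ∈ tsupport τ, ∀ s, |s - y.2| ≤ |t - y.1| → χ s = 1) →
    IsCommutator (smear ρ (fun x => (τ x.1 : ℂ) * (χ x.2 : ℂ))) (A y) (fun φ => q * A y φ)

/-- The current `ψ̄ γ_μ ψ = ∑ (γ⁰ γ_μ)ₐₐ ψₐ* ψₐ` (the matrices `γ⁰ γ_μ` are diagonal), with the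
products `ψₐ* ψₐ` given by `j a`. -/
def diracCurrent (j : Fin 2 → Spacetime → Functional) (μ : Fin 2) (x : Spacetime) : Functional :=
  fun φ => ∑ a, (gamma 0 * gammaLow μ) a a * j a x φ

/-- The massless Thirring field equation `γ^μ (i ∂_μ - g ψ̄ γ_μ ψ) ψ = 0` with coupling `g`, the
current being built from `j a = ψₐ* ψₐ`, all products being normal ordered. -/
def SatisfiesThirring (g : ℝ) (ψ j : Fin 2 → Spacetime → Functional) : Prop :=
  ∀ φ, OnShell φ → (∀ a, Differentiable ℝ (fun x => ψ a x φ)) ∧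
    ∀ x, ∑ μ : Fin 2, gamma μ *ᵥ (fun a : Fin 2 =>
      Complex.I * fderiv ℝ (fun y => ψ a y φ) x (![(1, 0), (0, 1)] μ)
        - g * diracCurrent j μ x φ * ψ a x φ) = 0

/-- `N` is the normal ordered mass term `N(ψ̄ψ)`,
`N(ψ̄ψ)(x) = lim_{y → x} |(x-y)²|^{-κ} ∑ (γ⁰)_{ab} ψₐ*(x) ⋆ ψ_b(y)`, `κ = α²/4π - π/4α²`,
the limit being taken through points `y` spacelike to `x`. -/
def IsMassTerm (α : ℝ) (N : Spacetime → Functional) : Prop :=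
  ∀ x, ∃ P : Fin 2 → Fin 2 → Spacetime → Functional,
    (∀ a b y, Spacelike x y → IsStarProduct (fermiAdj α a x) (fermi α b y) (P a b y)) ∧
    ∀ φ, Tendsto (fun y =>
        ((|lorentzSq (x - y)| ^ (-(α ^ 2 / (4 * Real.pi) - Real.pi / (4 * α ^ 2))) : ℝ) : ℂ)
          * ∑ a, ∑ b, gamma 0 a b * P a b y φ)
      (𝓝[{y | Spacelike x y}] x) (𝓝 (N x φ))

/-- The symbol of `:cos(βΦ(x)):`. -/
def cosField (β : ℝ) (x : Spacetime) : Functional :=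
  fun φ => (Real.cos (β * φ.1 0 x) : ℂ)

end Thirring

end

/-!
Normal ordered exponentials are closed under the star product. Every functional derivative of
`exp(i ∑ cᵢ φᵢ(x))` is multiplication by `i cᵢ δ_x`, so the series defining the product of two vertex
operators with exponents `c`, `d` is an exponential series (`hasSum_vertexDeriv`): the product is the
pointwise product of the symbols times the kernel `exp(-∑ cᵢ dⱼ W_{ε,ij}(x - y))`. Since the entries of
`W_ε` are combinations of two logarithms, the kernel is
`(iu + ε)^p (iv + ε)^q` times a phase, with `p = (c₀ + c₁)(d₀ + d₁) / 4π` and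
`q = (c₀ - c₁)(d₀ - d₁) / 4π` (`vertexKernel_eq`). All assertions are read off from this formula.

* At spacelike separation the boundary values of the kernels of the two orderings have the same
  modulus, and their phases add up to `2 cos(c₀ d₁ / 2)` or `2 cos(c₁ d₀ / 2)`, depending on the wedge
  (`vertexKernel_add_swap_eq_zero`). For the Fermi fields the arguments of the cosines are `±π/2`.
* For `α = √π` the exponents `p`, `q` are `0`, `1` or `-1`. Only `ψₐ*` with `ψₐ` produces a pole,
  `1/(iw + ε)` with `w = u` or `w = v`. An integration by parts turns it into a logarithmic potential,
  which converges as `ε ↓ 0` by dominated convergence (`tendsto_integral_logConv`). The sum of the two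
  orderings is governed by the jump `ln(iw) - ln(-iw) = iπ sgn w`, whose derivative is `2πi δ(w)`
  (`logConv_sub_logConv`).
* For `ψₐ* ⋆ ψₐ` and general `α` the power of `|(x-y)²|` cancels all of the kernel except for
  `1/(iw)`, so that the normal product is a first-order Taylor coefficient of
  `exp(i(θ(y) - θ(x)))`, `θ` being the phase of `ψₐ` (`isNormalDensity_normalDensity`). For the mass
  term the kernel is cancelled completely (`isMassTerm_cosField`).
* The charge density is linear in the field, so its star product with `ψₐ` has a single contraction.
  After an integration by parts in `x¹` the commutator is again an integral of the jump of the
  logarithms, against the derivative of the spatial cutoff (`isCommutator_linear_vertex`).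
-/

noncomputable section

namespace Thirring

/-! ### Functional derivatives of smeared vertex operators -/

theorem contDiff_config (φ : Config) (i : Fin 2) : ContDiff ℝ ∞ (φ.1 i) := φ.2 i

theorem continuous_config (φ : Config) (i : Fin 2) : Continuous (φ.1 i) := (contDiff_config φ i).continuous

theorem continuous_vertex (c : Fin 2 → ℝ) (φ : Config) : Continuous fun x => vertex c x φ := by
  unfold vertex
  have := fun i => continuous_config φ i
  fun_prop

theorem norm_vertex (c : Fin 2 → ℝ) (x : Spacetime) (φ : Config) : ‖vertex c x φ‖ = 1 := by
  have : vertex c x φ = Complex.exp (((∑ i, c i * φ.1 i x : ℝ) : ℂ) * Complex.I) := by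
    unfold vertex; push_cast; ring_nf
  rw [this, Complex.norm_exp_ofReal_mul_I]

/-- The symbol of `∫ f(x) :exp(i(a Φ(x) + b Φ̃(x))): dμ(x)`, with `c = (a, b)`. A Dirac measure `μ`
gives the vertex operator at a point, Lebesgue measure the one smeared with `f`. -/
def smearedVertex (μ : Measure Spacetime) (f : Spacetime → ℂ) (c : Fin 2 → ℝ) : Functional :=
  fun φ => ∫ x, f x * vertex c x φ ∂μ

/-- The complex measure `f μ` is finite and supported in the ball of radius `R`. -/
structure IsSource (μ : Measure Spacetime) (f : Spacetime → ℂ) (R : ℝ) : Prop where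
  integrable : Integrable f μ
  support : ∀ᵐ x ∂μ, R < ‖x‖ → f x = 0

theorem IsSource.exists_norm_mul_le {μ : Measure Spacetime} {f : Spacetime → ℂ} {R : ℝ}
    (h : IsSource μ f R) {g : Spacetime → ℂ} {C : ℝ} (hC : ∀ x, ‖x‖ ≤ R → ‖g x‖ ≤ C) :
    ∀ᵐ x ∂μ, ‖f x * g x‖ ≤ ‖f x‖ * C := by
  filter_upwards [h.support] with x hx
  by_cases hR : ‖x‖ ≤ R
  · rw [norm_mul]
    exact mul_le_mul_of_nonneg_left (hC x hR) (norm_nonneg _)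
  · simp [hx (not_le.mp hR)]

theorem exists_bound_closedBall {g : Spacetime → ℂ} (hg : Continuous g) (R : ℝ) :
    ∃ C, 0 ≤ C ∧ ∀ x, ‖x‖ ≤ R → ‖g x‖ ≤ C := by
  obtain ⟨C, hC⟩ := (isCompact_closedBall (0 : Spacetime) R).exists_bound_of_continuousOn
    hg.continuousOn
  exact ⟨max C 0, le_max_right _ _,
    fun x hx => (hC x (by simpa using hx)).trans (le_max_left _ _)⟩

theorem IsSource.integrable_mul {μ : Measure Spacetime} {f : Spacetime → ℂ} {R : ℝ}
    (h : IsSource μ f R) {g : Spacetime → ℂ} (hg : Continuous g) :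
    Integrable (fun x => f x * g x) μ := by
  obtain ⟨C, -, hC⟩ := exists_bound_closedBall hg R
  exact (h.integrable.norm.mul_const C).mono'
    (h.integrable.aestronglyMeasurable.mul hg.aestronglyMeasurable) (h.exists_norm_mul_le hC)

/-- Each functional derivative of `exp(i ∑ cᵢ φᵢ(x))` in direction `i` is multiplication by
`i cᵢ δ_x`. -/
def vertexDeriv (μ : Measure Spacetime) (f : Spacetime → ℂ) (c : Fin 2 → ℝ) (n : ℕ) (φ : Config)
    (I : Fin n → Fin 2) (T : (Fin n → Spacetime) → ℂ) : ℂ :=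
  ∫ x, f x * (vertex c x φ * ((∏ k, Complex.I * (c (I k) : ℂ)) * T fun _ => x)) ∂μ

theorem hasDerivAt_vertex (c : Fin 2 → ℝ) (x : Spacetime) (φ h : Config) (t : ℝ) :
    HasDerivAt (fun t : ℝ => vertex c x (φ + t • h))
      (vertex c x (φ + t • h) * (Complex.I * ∑ i, (c i : ℂ) * (h.1 i x : ℂ))) t := by
  unfold vertex
  have h1 : ∀ i : Fin 2, HasDerivAt (fun t : ℝ => (((φ + t • h : Config).1 i x : ℝ) : ℂ))
      (h.1 i x : ℂ) t := by
    intro i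
    have : HasDerivAt (fun t : ℝ => (φ + t • h : Config).1 i x) (h.1 i x) t := by
      simpa using ((hasDerivAt_id t).mul_const (h.1 i x)).const_add (φ.1 i x)
    exact this.ofReal_comp
  exact ((HasDerivAt.fun_sum fun i _ => (h1 i).const_mul (c i : ℂ)).const_mul Complex.I).cexp

theorem continuous_diag {n : ℕ} {T : (Fin n → Spacetime) → ℂ} (hT : Continuous T) :
    Continuous fun x : Spacetime => T fun _ => x :=
  hT.comp (continuous_pi fun _ => continuous_id)

/-- The functional derivatives of a smeared vertex operator. -/
def vertexDerivatives {μ : Measure Spacetime} {f : Spacetime → ℂ} {R : ℝ} (hf : IsSource μ f R)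
    (c : Fin 2 → ℝ) : FunctionalDerivatives (smearedVertex μ f c) where
  D := vertexDeriv μ f c
  map_add n φ I T T' hT hT' := by
    unfold vertexDeriv
    have hV := continuous_vertex c φ
    rw [← integral_add]
    · congr 1; ext x; ring
    · exact hf.integrable_mul (hV.mul (continuous_const.mul (continuous_diag hT.continuous)))
    · exact hf.integrable_mul (hV.mul (continuous_const.mul (continuous_diag hT'.continuous)))
  map_smul n φ I a T hT := by
    unfold vertexDeriv
    rw [← integral_const_mul]
    congr 1; ext x; ring
  bound n φ I := by
    refine ⟨0, R, ∫ x, ‖f x‖ * ‖∏ k, Complex.I * (c (I k) : ℂ)‖ ∂μ, fun T hT B hB => ?_⟩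
    unfold vertexDeriv
    rw [← integral_mul_const]
    refine norm_integral_le_of_norm_le ((hf.integrable.norm.mul_const _).mul_const _) ?_
    have := hf.exists_norm_mul_le (C := ‖∏ k, Complex.I * (c (I k) : ℂ)‖ * B)
      (g := fun x => vertex c x φ * ((∏ k, Complex.I * (c (I k) : ℂ)) * T fun _ => x)) ?_
    · simpa only [mul_assoc] using this
    · intro x hx
      rw [norm_mul, norm_mul, norm_vertex, one_mul]
      refine mul_le_mul_of_nonneg_left ?_ (norm_nonneg _)
      have h0 := hB 0 le_rfl (fun _ => x)
        ((pi_norm_le_iff_of_nonneg ((norm_nonneg x).trans hx)).mpr fun _ => hx)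
      rwa [norm_iteratedFDeriv_zero] at h0
  zeroth φ I T := by
    unfold vertexDeriv smearedVertex
    rw [← integral_mul_const]
    congr 1; ext x
    simp only [Finset.univ_eq_empty, Finset.prod_empty, one_mul, mul_assoc]
    congr 3
    exact Subsingleton.elim _ _
  succ n φ I T hT h := by
    unfold vertexDeriv
    set m : ℂ := ∏ k, Complex.I * (c (I k) : ℂ) with hm
    have hc : ∀ i, Continuous fun x => h.1 i x := fun i => continuous_config h i
    have hTd := continuous_diag hT.continuous
    have hg : Continuous fun x => (Complex.I * ∑ i, (c i : ℂ) * (h.1 i x : ℂ)) * (m * T fun _ => x) := by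
      fun_prop
    obtain ⟨C, hC0, hC⟩ := exists_bound_closedBall hg R
    have hV := fun t : ℝ => continuous_vertex c (φ + t • h)
    have key := (hasDerivAt_integral_of_dominated_loc_of_deriv_le (μ := μ) (x₀ := (0 : ℝ))
      (s := Set.univ) (bound := fun x => ‖f x‖ * C)
      (F := fun (t : ℝ) x => f x * (vertex c x (φ + t • h) * (m * T fun _ => x)))
      (F' := fun (t : ℝ) x => f x * (vertex c x (φ + t • h) *
        ((Complex.I * ∑ i, (c i : ℂ) * (h.1 i x : ℂ)) * (m * T fun _ => x))))
      univ_mem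
      (Eventually.of_forall fun t => (hf.integrable_mul
        ((hV t).mul (continuous_const.mul hTd))).aestronglyMeasurable)
      (hf.integrable_mul ((hV 0).mul (continuous_const.mul hTd)))
      (hf.integrable_mul ((hV 0).mul hg)).aestronglyMeasurable ?_
      (hf.integrable.norm.mul_const C) ?_).2
    · refine key.congr_deriv ?_
      rw [← integral_finsetSum]
      · congr 1; ext x
        simp only [zero_smul, add_zero, Fin.prod_univ_succ, Fin.cons_zero, Fin.cons_succ, ← hm,
          Finset.mul_sum, Finset.sum_mul]
        refine Finset.sum_congr rfl fun i _ => ?_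
        have : Fin.tail (fun _ : Fin (n + 1) => x) = fun _ => x := rfl
        rw [this]
        ring
      · intro i _
        refine hf.integrable_mul ((continuous_vertex c φ).mul (continuous_const.mul ?_))
        exact (Complex.continuous_ofReal.comp (hc i)).mul hTd
    · have : ∀ᵐ x ∂μ, ∀ t : ℝ, ‖f x * (vertex c x (φ + t • h) *
        ((Complex.I * ∑ i, (c i : ℂ) * (h.1 i x : ℂ)) * (m * T fun _ => x)))‖ ≤ ‖f x‖ * C := by
        filter_upwards [hf.exists_norm_mul_le hC] with x hx t
        rw [norm_mul, norm_mul (vertex _ _ _), norm_vertex, one_mul, ← norm_mul]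
        exact hx
      filter_upwards [this] with x hx t _ using hx t
    · refine ae_of_all _ fun x t _ => ?_
      have := ((hasDerivAt_vertex c x φ h t).mul_const (m * T fun _ => x)).const_mul (f x)
      refine this.congr_deriv ?_
      ring

/-! ### The star product of smeared vertex operators -/

/-- The kernel `exp(-∑ cᵢ dⱼ W_{ε,ij}(z))` which the contractions produce between vertex operators
with exponents `c` and `d`. -/
def vertexKernel (c d : Fin 2 → ℝ) (ε : ℝ) (z : Spacetime) : ℂ :=
  Complex.exp (∑ i, ∑ j, Complex.I * c i * (Complex.I * d j) * twoPointReg ε i j z)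

theorem ofReal_mul_I_add_mem_slitPlane (s : ℝ) {ε : ℝ} (hε : 0 < ε) :
    Complex.I * s + ε ∈ Complex.slitPlane := by
  left; simpa using hε

theorem continuous_lcU : Continuous lcU := by unfold lcU; fun_prop

theorem continuous_lcV : Continuous lcV := by unfold lcV; fun_prop

theorem continuous_log_reg {s : Spacetime → ℝ} (hs : Continuous s) {ε : ℝ} (hε : 0 < ε) :
    Continuous fun z => Complex.log (Complex.I * s z + ε) := by
  refine Continuous.clog (by fun_prop) fun z => ofReal_mul_I_add_mem_slitPlane _ hε

theorem continuous_twoPointReg {ε : ℝ} (hε : 0 < ε) (i j : Fin 2) :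
    Continuous (twoPointReg ε i j) := by
  have h1 := continuous_log_reg continuous_lcU hε
  have h2 := continuous_log_reg continuous_lcV hε
  have hp : Continuous fun z => -(1 / (4 * (Real.pi : ℂ))) *
      (Complex.log (Complex.I * lcU z + ε) + Complex.log (Complex.I * lcV z + ε)) := by fun_prop
  have hm : Continuous fun z => -(1 / (4 * (Real.pi : ℂ))) *
      (Complex.log (Complex.I * lcU z + ε) - Complex.log (Complex.I * lcV z + ε)) := by fun_prop
  fin_cases i <;> fin_cases j
  · exact hp
  · exact hm.sub continuous_const
  · exact hm.add continuous_const
  · exact hp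

theorem continuous_vertexKernel (c d : Fin 2 → ℝ) {ε : ℝ} (hε : 0 < ε) :
    Continuous (vertexKernel c d ε) := by
  have := fun i j => continuous_twoPointReg hε i j
  unfold vertexKernel
  fun_prop

theorem sum_sum_prod_eq_pow {n : ℕ} (a : Fin 2 → Fin 2 → ℂ) :
    ∑ I : Fin n → Fin 2, ∑ J : Fin n → Fin 2, ∏ k, a (I k) (J k) = (∑ i, ∑ j, a i j) ^ n := by
  have h1 : ∀ I : Fin n → Fin 2, ∑ J : Fin n → Fin 2, ∏ k, a (I k) (J k) = ∏ k, ∑ j, a (I k) j :=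
    fun I => (Fintype.prod_sum fun k j => a (I k) j).symm
  simp only [h1]
  rw [← Fintype.prod_sum (fun _ i => ∑ j, a i j)]
  simp

section WickTheorem

variable {μ ν : Measure Spacetime} {f g : Spacetime → ℂ} {R R' : ℝ}

theorem exists_bound_closedBall_sub {w : Spacetime → ℂ} (hw : Continuous w) (R R' : ℝ) :
    ∃ C, 0 ≤ C ∧ ∀ p : Spacetime × Spacetime, ‖p.1‖ ≤ R → ‖p.2‖ ≤ R' → ‖w (p.1 - p.2)‖ ≤ C := by
  obtain ⟨C, hC0, hC⟩ := exists_bound_closedBall hw (R + R')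
  exact ⟨C, hC0, fun p h1 h2 => hC _ ((norm_sub_le _ _).trans (add_le_add h1 h2))⟩

theorem IsSource.ae_prod [SFinite μ] [SFinite ν] (hf : IsSource μ f R) (hg : IsSource ν g R') :
    ∀ᵐ p ∂μ.prod ν, ¬ (‖p.1‖ ≤ R ∧ ‖p.2‖ ≤ R') → f p.1 * g p.2 = 0 := by
  have h1 := Measure.quasiMeasurePreserving_fst (μ := μ) (ν := ν) |>.ae hf.support
  have h2 := Measure.quasiMeasurePreserving_snd (μ := μ) (ν := ν) |>.ae hg.support
  filter_upwards [h1, h2] with p hp1 hp2 hn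
  by_cases h : ‖p.1‖ ≤ R
  · have : R' < ‖p.2‖ := by
      by_contra hh
      exact hn ⟨h, not_lt.mp hh⟩
    simp [hp2 this]
  · simp [hp1 (not_le.mp h)]

/-- The integrand of the two-point functional with kernel `w(x - y)`. -/
def bilocal (f g : Spacetime → ℂ) (c d : Fin 2 → ℝ) (φ : Config) (w : Spacetime → ℂ)
    (p : Spacetime × Spacetime) : ℂ :=
  f p.1 * g p.2 * (vertex c p.1 φ * vertex d p.2 φ * w (p.1 - p.2))

theorem IsSource.integrable_bilocal [SFinite μ] [SFinite ν] (hf : IsSource μ f R)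
    (hg : IsSource ν g R') (c d : Fin 2 → ℝ) (φ : Config) {w : Spacetime → ℂ} (hw : Continuous w) :
    Integrable (bilocal f g c d φ w) (μ.prod ν) := by
  obtain ⟨C, hC0, hC⟩ := exists_bound_closedBall_sub hw R R'
  have hfg := hf.integrable.mul_prod hg.integrable
  have hV := continuous_vertex c φ
  have hV' := continuous_vertex d φ
  refine (hfg.norm.mul_const C).mono' (hfg.aestronglyMeasurable.mul
    (Continuous.aestronglyMeasurable (by fun_prop))) ?_
  filter_upwards [hf.ae_prod hg] with p hp
  by_cases h : ‖p.1‖ ≤ R ∧ ‖p.2‖ ≤ R'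
  · simp only [bilocal]
    rw [norm_mul, norm_mul (_ * _), norm_mul (vertex _ _ _), norm_vertex, norm_vertex, one_mul,
      one_mul]
    exact mul_le_mul_of_nonneg_left (hC p h.1 h.2) (norm_nonneg _)
  · simp only [bilocal]
    rw [hp h]; simp

/-- Wick's theorem for smeared vertex operators: the series defining the regularized star product
sums to the exponential kernel. -/
theorem hasSum_vertexDeriv [SFinite μ] [SFinite ν] (hf : IsSource μ f R) (hg : IsSource ν g R')
    (c d : Fin 2 → ℝ) (φ : Config) {ε : ℝ} (hε : 0 < ε) :
    HasSum (fun n : ℕ => (n.factorial : ℂ)⁻¹ * ∑ I : Fin n → Fin 2, ∑ J : Fin n → Fin 2,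
        vertexDeriv μ f c n φ I (fun x => vertexDeriv ν g d n φ J
          (fun y => ∏ k, twoPointReg ε (I k) (J k) (x k - y k))))
      (∫ p, bilocal f g c d φ (vertexKernel c d ε) p ∂μ.prod ν) := by
  set a : Fin 2 → Fin 2 → Spacetime → ℂ :=
    fun i j z => Complex.I * c i * (Complex.I * d j) * twoPointReg ε i j z with ha
  have hW := fun i j => continuous_twoPointReg hε i j
  have hac : ∀ i j, Continuous (a i j) := fun i j => by simp only [ha]; fun_prop
  set κ : Spacetime → ℂ := fun z => ∑ i, ∑ j, a i j z with hκ
  have hκc : Continuous κ := by simp only [hκ]; fun_prop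
  -- all derivatives are diagonal, so the `n`-th term contracts the same two points `n` times
  have hterm : ∀ n : ℕ, (n.factorial : ℂ)⁻¹ * ∑ I : Fin n → Fin 2, ∑ J : Fin n → Fin 2,
        vertexDeriv μ f c n φ I (fun x => vertexDeriv ν g d n φ J
          (fun y => ∏ k, twoPointReg ε (I k) (J k) (x k - y k))) =
      ∫ p, bilocal f g c d φ (fun z => (n.factorial : ℂ)⁻¹ * κ z ^ n) p ∂μ.prod ν := by
    intro n
    have h1 : ∀ I J : Fin n → Fin 2, vertexDeriv μ f c n φ I (fun x => vertexDeriv ν g d n φ J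
          (fun y => ∏ k, twoPointReg ε (I k) (J k) (x k - y k))) =
        ∫ p, bilocal f g c d φ (fun z => ∏ k, a (I k) (J k) z) p ∂μ.prod ν := by
      intro I J
      rw [integral_prod _ (hf.integrable_bilocal hg c d φ
        (continuous_finsetProd _ fun k _ => hac _ _))]
      unfold vertexDeriv
      congr 1; ext x
      rw [← mul_assoc, ← mul_assoc, ← integral_const_mul]
      congr 1; ext y
      simp only [bilocal, ha, Finset.prod_mul_distrib]
      ring
    simp only [h1]
    have hint : ∀ I J : Fin n → Fin 2, Integrable
        (bilocal f g c d φ (fun z => ∏ k, a (I k) (J k) z)) (μ.prod ν) := fun I J =>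
      hf.integrable_bilocal hg c d φ (continuous_finsetProd _ fun k _ => hac _ _)
    have h2 : ∀ I : Fin n → Fin 2, ∑ J : Fin n → Fin 2,
        ∫ p, bilocal f g c d φ (fun z => ∏ k, a (I k) (J k) z) p ∂μ.prod ν =
        ∫ p, ∑ J : Fin n → Fin 2, bilocal f g c d φ (fun z => ∏ k, a (I k) (J k) z) p ∂μ.prod ν :=
      fun I => (integral_finsetSum _ fun J _ => hint I J).symm
    simp only [h2]
    rw [← integral_finsetSum _ fun I _ => integrable_finsetSum _ fun J _ => hint I J,
      ← integral_const_mul]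
    congr 1; ext p
    simp only [bilocal, hκ, ← sum_sum_prod_eq_pow, Finset.mul_sum]
    refine Finset.sum_congr rfl fun I _ => Finset.sum_congr rfl fun J _ => ?_
    ring
  simp only [hterm]
  -- the kernel is bounded on the compact supports, so `C ^ n / n!` dominates the exponential series
  obtain ⟨C, hC0, hC⟩ := exists_bound_closedBall_sub hκc R R'
  have hfg := hf.integrable.mul_prod hg.integrable
  refine hasSum_integral_of_dominated_convergence
    (fun n p => ‖f p.1 * g p.2‖ * ((n.factorial : ℝ)⁻¹ * C ^ n)) (fun n => ?_) (fun n => ?_) ?_ ?_ ?_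
  · exact (hf.integrable_bilocal hg c d φ (by fun_prop)).aestronglyMeasurable
  · filter_upwards [hf.ae_prod hg] with p hp
    by_cases h : ‖p.1‖ ≤ R ∧ ‖p.2‖ ≤ R'
    · simp only [bilocal]
      rw [norm_mul, norm_mul (_ * _), norm_mul (vertex _ _ _), norm_vertex, norm_vertex, one_mul,
        one_mul, norm_mul (_⁻¹), norm_pow, norm_inv, Complex.norm_natCast]
      gcongr
      exact hC p h.1 h.2
    · simp only [bilocal]
      rw [hp h]; simp
  · refine ae_of_all _ fun p => Summable.mul_left _ ?_
    simpa [div_eq_inv_mul] using Real.summable_pow_div_factorial C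
  · have : ∀ p : Spacetime × Spacetime, ∑' n : ℕ, ‖f p.1 * g p.2‖ * ((n.factorial : ℝ)⁻¹ * C ^ n) =
        ‖f p.1 * g p.2‖ * ∑' n : ℕ, ((n.factorial : ℝ)⁻¹ * C ^ n) := fun p => tsum_mul_left
    simp only [this]
    exact hfg.norm.mul_const _
  · refine ae_of_all _ fun p => ?_
    simp only [bilocal]
    refine (HasSum.mul_left _ ?_).mul_left _
    have := NormedSpace.expSeries_div_hasSum_exp (𝔸 := ℂ) (κ (p.1 - p.2))
    rw [← Complex.exp_eq_exp_ℂ] at this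
    simpa [vertexKernel, hκ, ha, div_eq_inv_mul] using this

/-- The star product of smeared vertex operators exists if the regularized kernels converge weakly. -/
theorem isStarProduct_smearedVertex [SFinite μ] [SFinite ν] (hf : IsSource μ f R)
    (hg : IsSource ν g R') (c d : Fin 2 → ℝ) {K : Functional}
    (hK : ∀ φ, Tendsto (fun ε => ∫ p, bilocal f g c d φ (vertexKernel c d ε) p ∂μ.prod ν)
      (𝓝[>] 0) (𝓝 (K φ))) :
    IsStarProduct (smearedVertex μ f c) (smearedVertex ν g d) K :=
  ⟨vertexDerivatives hf c, vertexDerivatives hg d, fun φ =>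
    ⟨_, fun _ hε => hasSum_vertexDeriv hf hg c d φ hε, hK φ⟩⟩

end WickTheorem

/-! ### The kernel of two vertex operators -/

/-- The exponent with which `iu + ε` enters the kernel. -/
def expU (c d : Fin 2 → ℝ) : ℝ := (c 0 + c 1) * (d 0 + d 1) / (4 * Real.pi)

/-- The exponent with which `iv + ε` enters the kernel. -/
def expV (c d : Fin 2 → ℝ) : ℝ := (c 0 - c 1) * (d 0 - d 1) / (4 * Real.pi)

theorem vertexKernel_eq (c d : Fin 2 → ℝ) (ε : ℝ) (z : Spacetime) :
    vertexKernel c d ε z = Complex.exp (expU c d * Complex.log (Complex.I * lcU z + ε) +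
      expV c d * Complex.log (Complex.I * lcV z + ε) +
      Complex.I / 4 * (c 0 * d 1 - c 1 * d 0)) := by
  have hpi : (Real.pi : ℂ) ≠ 0 := by exact_mod_cast Real.pi_ne_zero
  unfold vertexKernel
  congr 1
  simp only [Fin.sum_univ_two, twoPointReg, expU, expV, Matrix.of_apply, Matrix.cons_val',
    Matrix.cons_val_zero, Matrix.cons_val_one, Matrix.cons_val_fin_one]
  push_cast
  field_simp
  ring_nf
  simp only [Complex.I_sq]
  ring_nf
  have : Complex.I ^ 3 = -Complex.I := by
    rw [pow_succ, Complex.I_sq]; ring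
  rw [this]
  ring

theorem continuousAt_vertexKernel (c d : Fin 2 → ℝ) (ε : ℝ) {z : Spacetime} (hu : lcU z ≠ 0)
    (hv : lcV z ≠ 0) :
    ContinuousAt (fun q : ℝ × Spacetime => vertexKernel c d q.1 q.2) (ε, z) := by
  have key : ∀ {s : Spacetime → ℝ}, Continuous s → s z ≠ 0 → ContinuousAt
      (fun q : ℝ × Spacetime => Complex.log (Complex.I * s q.2 + q.1)) (ε, z) := by
    intro s hs h
    refine ContinuousAt.clog (Continuous.continuousAt (by fun_prop)) ?_
    right
    simpa using h
  have h1 := key continuous_lcU hu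
  have h2 := key continuous_lcV hv
  simp only [vertexKernel_eq]
  fun_prop

theorem Spacelike.lcU_ne_zero {x y : Spacetime} (h : Spacelike x y) : lcU (x - y) ≠ 0 := by
  intro h0
  simp [Spacelike, lorentzSq, h0] at h

theorem Spacelike.lcV_ne_zero {x y : Spacetime} (h : Spacelike x y) : lcV (x - y) ≠ 0 := by
  intro h0
  simp [Spacelike, lorentzSq, h0] at h

theorem lcU_neg (z : Spacetime) : lcU (-z) = -lcU z := by simp [lcU]; ring

theorem lcV_neg (z : Spacetime) : lcV (-z) = -lcV z := by simp [lcV]; ring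

theorem lorentzSq_neg (z : Spacetime) : lorentzSq (-z) = lorentzSq z := by
  simp [lorentzSq, lcU_neg, lcV_neg]

theorem log_I_mul_of_pos {s : ℝ} (hs : 0 < s) :
    Complex.log (Complex.I * s) = Real.log |s| + Real.pi / 2 * Complex.I := by
  rw [mul_comm, Complex.log_ofReal_mul hs (by simp), Complex.log_I, abs_of_pos hs]

theorem log_I_mul_of_neg {s : ℝ} (hs : s < 0) :
    Complex.log (Complex.I * s) = Real.log |s| - Real.pi / 2 * Complex.I := by
  have e : Complex.I * (s : ℂ) = ((-s : ℝ) : ℂ) * (-Complex.I) := by push_cast; ring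
  rw [e, Complex.log_ofReal_mul (by linarith) (by simp), Complex.log_neg_I, abs_of_neg hs]
  ring

/-- The boundary value of the kernel in the right spacelike wedge. -/
theorem vertexKernel_zero_of_pos (c d : Fin 2 → ℝ) {z : Spacetime} (hz : lorentzSq z < 0)
    (hu : 0 < lcU z) :
    vertexKernel c d 0 z = ((|lcU z| ^ expU c d * |lcV z| ^ expV c d : ℝ) : ℂ) *
      Complex.exp (Complex.I / 2 * (c 0 * d 1)) := by
  have hv : lcV z < 0 := by
    unfold lorentzSq at hz
    exact (mul_neg_iff.mp hz).resolve_right (fun h => absurd h.1 (not_lt.mpr hu.le)) |>.2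
  have hpi : (Real.pi : ℂ) ≠ 0 := by exact_mod_cast Real.pi_ne_zero
  rw [vertexKernel_eq, Complex.ofReal_zero, add_zero, add_zero, log_I_mul_of_pos hu,
    log_I_mul_of_neg hv, Real.rpow_def_of_pos (abs_pos.mpr hu.ne'),
    Real.rpow_def_of_pos (abs_pos.mpr hv.ne), ← Real.exp_add, Complex.ofReal_exp, ← Complex.exp_add]
  congr 1
  simp only [expU, expV]
  push_cast
  field_simp
  ring

/-- The boundary value of the kernel in the left spacelike wedge. -/
theorem vertexKernel_zero_of_neg (c d : Fin 2 → ℝ) {z : Spacetime} (hz : lorentzSq z < 0)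
    (hu : lcU z < 0) :
    vertexKernel c d 0 z = ((|lcU z| ^ expU c d * |lcV z| ^ expV c d : ℝ) : ℂ) *
      Complex.exp (-(Complex.I / 2 * (c 1 * d 0))) := by
  have hv : 0 < lcV z := by
    unfold lorentzSq at hz
    exact (mul_neg_iff.mp hz).resolve_left (fun h => absurd h.1 (not_lt.mpr hu.le)) |>.2
  have hpi : (Real.pi : ℂ) ≠ 0 := by exact_mod_cast Real.pi_ne_zero
  rw [vertexKernel_eq, Complex.ofReal_zero, add_zero, add_zero, log_I_mul_of_neg hu,
    log_I_mul_of_pos hv, Real.rpow_def_of_pos (abs_pos.mpr hu.ne),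
    Real.rpow_def_of_pos (abs_pos.mpr hv.ne'), ← Real.exp_add, Complex.ofReal_exp, ← Complex.exp_add]
  congr 1
  simp only [expU, expV]
  push_cast
  field_simp
  ring

theorem expU_comm (c d : Fin 2 → ℝ) : expU c d = expU d c := by unfold expU; ring

theorem expV_comm (c d : Fin 2 → ℝ) : expV c d = expV d c := by unfold expV; ring

theorem exp_add_exp_neg_eq_zero {t : ℝ} (h : Real.cos (t / 2) = 0) :
    Complex.exp (Complex.I / 2 * t) + Complex.exp (-(Complex.I / 2 * t)) = 0 := by
  have h1 : Complex.I / 2 * (t : ℂ) = ((t / 2 : ℝ) : ℂ) * Complex.I := by push_cast; ring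
  have h2 := Complex.two_cos ((t / 2 : ℝ) : ℂ)
  rw [h1, ← neg_mul, ← h2, ← Complex.ofReal_cos, h]
  simp

/-- At spacelike separation the two orderings of vertex operators differ by the phases
`exp(i c₀ d₁)` and `exp(-i c₁ d₀)` in the two wedges. -/
theorem vertexKernel_add_swap_eq_zero {c d : Fin 2 → ℝ} (h1 : Real.cos (c 0 * d 1 / 2) = 0)
    (h2 : Real.cos (c 1 * d 0 / 2) = 0) {z : Spacetime} (hz : lorentzSq z < 0) :
    vertexKernel c d 0 z + vertexKernel d c 0 (-z) = 0 := by
  have hz' : lorentzSq (-z) < 0 := by rwa [lorentzSq_neg]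
  have h0 : lcU z ≠ 0 := by
    intro h0
    simp [lorentzSq, h0] at hz
  have e1 := exp_add_exp_neg_eq_zero h1
  have e2 := exp_add_exp_neg_eq_zero h2
  rcases lt_or_gt_of_ne h0 with hu | hu
  · rw [vertexKernel_zero_of_neg c d hz hu,
      vertexKernel_zero_of_pos d c hz' (by rw [lcU_neg]; linarith), lcU_neg, lcV_neg, abs_neg,
      abs_neg, expU_comm d c, expV_comm d c, ← mul_add, add_comm, mul_comm (d 0 : ℂ)]
    push_cast at e2
    rw [e2, mul_zero]
  · rw [vertexKernel_zero_of_pos c d hz hu,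
      vertexKernel_zero_of_neg d c hz' (by rw [lcU_neg]; linarith), lcU_neg, lcV_neg, abs_neg,
      abs_neg, expU_comm d c, expV_comm d c, ← mul_add, mul_comm (d 1 : ℂ)]
    push_cast at e1
    rw [e1, mul_zero]

/-! ### Star products away from the singularities of the kernel -/

theorem isSource_dirac (x : Spacetime) (A : ℂ) :
    IsSource (Measure.dirac x) (fun _ => A) ‖x‖ where
  integrable := integrable_const A
  support := by
    rw [ae_dirac_eq]
    exact fun h => absurd h (lt_irrefl _)

theorem smearedVertex_dirac (x : Spacetime) (A : ℂ) (c : Fin 2 → ℝ) :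
    smearedVertex (Measure.dirac x) (fun _ => A) c = fun φ => A * vertex c x φ := by
  ext φ
  simp [smearedVertex]

theorem isStarProduct_vertex (A B : ℂ) (c d : Fin 2 → ℝ) {x y : Spacetime} (h : Spacelike x y) :
    IsStarProduct (fun φ => A * vertex c x φ) (fun φ => B * vertex d y φ)
      (fun φ => A * B * (vertex c x φ * vertex d y φ * vertexKernel c d 0 (x - y))) := by
  rw [← smearedVertex_dirac, ← smearedVertex_dirac]
  refine isStarProduct_smearedVertex (isSource_dirac x A) (isSource_dirac y B) c d fun φ => ?_
  rw [Measure.dirac_prod_dirac]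
  simp only [integral_dirac, bilocal]
  have hc := continuousAt_vertexKernel c d 0 h.lcU_ne_zero h.lcV_ne_zero
  have : Tendsto (fun ε : ℝ => vertexKernel c d ε (x - y)) (𝓝[>] 0)
      (𝓝 (vertexKernel c d 0 (x - y))) :=
    (hc.comp (f := fun ε : ℝ => (ε, x - y)) (by fun_prop)).tendsto.mono_left nhdsWithin_le_nhds
  exact (this.const_mul _).const_mul _

theorem IsTest.isSource {f : Spacetime → ℂ} (hf : IsTest f) : ∃ R, IsSource volume f R := by
  obtain ⟨R, hR⟩ := hf.2.isCompact.isBounded.subset_closedBall (0 : Spacetime)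
  refine ⟨R, hf.1.continuous.integrable_of_hasCompactSupport hf.2, ae_of_all _ fun x hx => ?_⟩
  by_contra h
  have := hR (subset_tsupport f h)
  rw [mem_closedBall_zero_iff] at this
  linarith

/-- If the regularized kernel extends continuously to `ε = 0` on the relevant differences, the star
product of smeared vertex operators is given by its boundary value. -/
theorem isStarProduct_smeared_of_continuousAt {f g : Spacetime → ℂ} (hf : IsTest f) (hg : IsTest g)
    (c d : Fin 2 → ℝ) {w : ℝ → Spacetime → ℂ}
    (hw : ∀ ε ∈ Set.Icc (0 : ℝ) 1, ∀ x ∈ tsupport f, ∀ y ∈ tsupport g,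
      ContinuousAt (fun q : ℝ × Spacetime => w q.1 q.2) (ε, x - y))
    (hk : ∀ ε > 0, ∀ z, vertexKernel c d ε z = w ε z) :
    IsStarProduct (smearedVertex volume f c) (smearedVertex volume g d)
      (fun φ => ∫ p, bilocal f g c d φ (w 0) p ∂volume.prod volume) := by
  obtain ⟨R, hR⟩ := hf.isSource
  obtain ⟨R', hR'⟩ := hg.isSource
  refine isStarProduct_smearedVertex hR hR' c d fun φ => ?_
  obtain ⟨C, hC⟩ : ∃ C, ∀ q ∈ Set.Icc (0 : ℝ) 1 ×ˢ (tsupport f ×ˢ tsupport g),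
      ‖w q.1 (q.2.1 - q.2.2)‖ ≤ C := by
    refine (isCompact_Icc.prod (hf.2.isCompact.prod hg.2.isCompact)).exists_bound_of_continuousOn ?_
    rintro ⟨ε, x, y⟩ ⟨hε, hx, hy⟩
    exact (ContinuousAt.comp (x := (ε, x, y))
      (f := fun q : ℝ × Spacetime × Spacetime => (q.1, q.2.1 - q.2.2)) (hw ε hε x hx y hy)
      (by fun_prop)).continuousWithinAt
  have hfg := hR.integrable.mul_prod hR'.integrable
  refine tendsto_integral_filter_of_dominated_convergence (fun p => ‖f p.1 * g p.2‖ * C) ?_ ?_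
    (hfg.norm.mul_const C) (ae_of_all _ fun p => ?_)
  · filter_upwards [self_mem_nhdsWithin] with ε hε
    exact (hR.integrable_bilocal hR' c d φ (continuous_vertexKernel c d hε)).aestronglyMeasurable
  · filter_upwards [Ioc_mem_nhdsGT (zero_lt_one' ℝ)] with ε hε
    refine ae_of_all _ fun p => ?_
    simp only [bilocal]
    rw [norm_mul, norm_mul (_ * _) (vertexKernel _ _ _ _), norm_mul (vertex _ _ _), norm_vertex,
      norm_vertex, one_mul, one_mul]
    by_cases h : f p.1 * g p.2 = 0
    · simp [h]
    · refine mul_le_mul_of_nonneg_left ?_ (norm_nonneg _)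
      rw [hk ε hε.1]
      exact hC (ε, p) ⟨⟨hε.1.le, hε.2⟩, subset_tsupport _ (left_ne_zero_of_mul h),
        subset_tsupport _ (right_ne_zero_of_mul h)⟩
  · simp only [bilocal]
    by_cases h : f p.1 * g p.2 = 0
    · simp [h]
    · have hc := hw 0 ⟨le_rfl, zero_le_one⟩ p.1 (subset_tsupport _ (left_ne_zero_of_mul h))
        p.2 (subset_tsupport _ (right_ne_zero_of_mul h))
      have : Tendsto (fun ε : ℝ => w ε (p.1 - p.2)) (𝓝[>] 0) (𝓝 (w 0 (p.1 - p.2))) :=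
        (ContinuousAt.comp (f := fun ε : ℝ => (ε, p.1 - p.2)) hc
          (by fun_prop)).tendsto.mono_left nhdsWithin_le_nhds
      refine ((this.congr' ?_).const_mul _).const_mul _
      filter_upwards [self_mem_nhdsWithin] with ε hε using (hk ε hε _).symm

theorem isAnticommutator_smeared_of_continuousAt {f g : Spacetime → ℂ} (hf : IsTest f)
    (hg : IsTest g) (c d : Fin 2 → ℝ) {w w' : ℝ → Spacetime → ℂ}
    (hw : ∀ ε ∈ Set.Icc (0 : ℝ) 1, ∀ x ∈ tsupport f, ∀ y ∈ tsupport g,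
      ContinuousAt (fun q : ℝ × Spacetime => w q.1 q.2) (ε, x - y))
    (hw' : ∀ ε ∈ Set.Icc (0 : ℝ) 1, ∀ x ∈ tsupport f, ∀ y ∈ tsupport g,
      ContinuousAt (fun q : ℝ × Spacetime => w' q.1 q.2) (ε, y - x))
    (hk : ∀ ε > 0, ∀ z, vertexKernel c d ε z = w ε z)
    (hk' : ∀ ε > 0, ∀ z, vertexKernel d c ε z = w' ε z)
    (h0 : ∀ x ∈ tsupport f, ∀ y ∈ tsupport g, w 0 (x - y) + w' 0 (y - x) = 0) :
    IsAnticommutator (smearedVertex volume f c) (smearedVertex volume g d) 0 := by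
  refine ⟨_, _, isStarProduct_smeared_of_continuousAt hf hg c d hw hk,
    isStarProduct_smeared_of_continuousAt hg hf d c
      (fun ε hε x hx y hy => hw' ε hε y hy x hx) hk', fun φ _ => ?_⟩
  rw [Pi.zero_apply, add_eq_zero_iff_eq_neg, ← integral_neg,
    ← integral_prod_swap (μ := (volume : Measure Spacetime)) (ν := (volume : Measure Spacetime))]
  congr 1; ext p
  simp only [bilocal, Prod.fst_swap, Prod.snd_swap]
  by_cases h : f p.2 * g p.1 = 0
  · rw [mul_comm (g p.1), h]; simp
  · have := h0 p.2 (subset_tsupport _ (left_ne_zero_of_mul h)) p.1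
      (subset_tsupport _ (right_ne_zero_of_mul h))
    rw [eq_neg_of_add_eq_zero_left this]
    ring

/-- The field `A :exp(i(a Φ(x) + b Φ̃(x))):`. -/
def vertexField (A : ℂ) (c : Fin 2 → ℝ) : Spacetime → Functional := fun x φ => A * vertex c x φ

theorem adj_vertexField (A : ℂ) (c : Fin 2 → ℝ) :
    adj (vertexField A c) = vertexField ((starRingEnd ℂ) A) (-c) := by
  ext x φ
  simp only [adj, vertexField, vertex, map_mul, ← Complex.exp_conj, map_sum, Complex.conj_I,
    Complex.conj_ofReal, Pi.neg_apply, Complex.ofReal_neg, neg_mul, Finset.sum_neg_distrib,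
    mul_neg]

theorem smear_vertexField (A : ℂ) (c : Fin 2 → ℝ) (f : Spacetime → ℂ) :
    smear (vertexField A c) f = smearedVertex volume (fun x => A * f x) c := by
  ext φ
  simp only [smear, vertexField, smearedVertex]
  congr 1; ext x; ring

theorem IsTest.const_mul {f : Spacetime → ℂ} (hf : IsTest f) (A : ℂ) :
    IsTest (fun x => A * f x) :=
  ⟨contDiff_const.mul hf.1, hf.2.mul_left⟩

theorem tsupport_const_mul_subset (A : ℂ) (f : Spacetime → ℂ) :
    tsupport (fun x => A * f x) ⊆ tsupport f :=
  closure_mono (Function.support_mul_subset_right _ _)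

theorem anticommuteSpacelike_vertexField (A B : ℂ) {c d : Fin 2 → ℝ}
    (h1 : Real.cos (c 0 * d 1 / 2) = 0) (h2 : Real.cos (c 1 * d 0 / 2) = 0) :
    AnticommuteSpacelike (vertexField A c) (vertexField B d) := by
  refine ⟨fun x y h => ?_, fun f g hf hg h => ?_⟩
  · have h' : Spacelike y x := by
      unfold Spacelike at h ⊢
      rwa [← neg_sub, lorentzSq_neg]
    refine ⟨_, _, isStarProduct_vertex A B c d h, isStarProduct_vertex B A d c h', fun φ _ => ?_⟩
    have := vertexKernel_add_swap_eq_zero h1 h2 h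
    rw [neg_sub] at this
    rw [eq_neg_of_add_eq_zero_left this, Pi.zero_apply]
    ring
  · rw [smear_vertexField, smear_vertexField]
    have hs : ∀ x ∈ tsupport (fun x => A * f x), ∀ y ∈ tsupport (fun x => B * g x),
        Spacelike x y := fun x hx y hy =>
      h x (tsupport_const_mul_subset A f hx) y (tsupport_const_mul_subset B g hy)
    refine isAnticommutator_smeared_of_continuousAt (hf.const_mul A) (hg.const_mul B) c d
      (fun ε _ x hx y hy => ?_) (fun ε _ x hx y hy => ?_) (fun _ _ _ => rfl) (fun _ _ _ => rfl)
      (fun x hx y hy => ?_)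
    · exact continuousAt_vertexKernel c d ε (hs x hx y hy).lcU_ne_zero (hs x hx y hy).lcV_ne_zero
    · have hxy := hs x hx y hy
      refine continuousAt_vertexKernel d c ε ?_ ?_
      · rw [← neg_sub, lcU_neg]; exact neg_ne_zero.mpr hxy.lcU_ne_zero
      · rw [← neg_sub, lcV_neg]; exact neg_ne_zero.mpr hxy.lcV_ne_zero
    · have := vertexKernel_add_swap_eq_zero h1 h2 (hs x hx y hy)
      rwa [neg_sub] at this

/-! ### The exponents of the Fermi fields -/

/-- The exponents `(α, π/α)` of `ψ₊` and `(-α, π/α)` of `ψ₋`. -/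
def fermiExp (α : ℝ) : Fin 2 → Fin 2 → ℝ := ![![α, Real.pi / α], ![-α, Real.pi / α]]

/-- The normalization factors of `ψ₊` and `ψ₋`. -/
def fermiCoeff : Fin 2 → ℂ :=
  ![-Complex.I * ((Real.sqrt (2 * Real.pi))⁻¹ : ℝ), ((Real.sqrt (2 * Real.pi))⁻¹ : ℝ)]

theorem fermi_eq (α : ℝ) (a : Fin 2) : fermi α a = vertexField (fermiCoeff a) (fermiExp α a) := by
  fin_cases a <;> rfl

theorem fermiAdj_eq (α : ℝ) (a : Fin 2) :
    fermiAdj α a = vertexField ((starRingEnd ℂ) (fermiCoeff a)) (-fermiExp α a) := by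
  rw [fermiAdj, fermi_eq, adj_vertexField]

theorem cos_fermiExp_mul {α : ℝ} (hα : 0 < α) (a b : Fin 2) :
    Real.cos (fermiExp α a 0 * fermiExp α b 1 / 2) = 0 := by
  have h1 : α * (Real.pi / α) / 2 = Real.pi / 2 := by field_simp
  have h2 : -α * (Real.pi / α) / 2 = -(Real.pi / 2) := by field_simp
  fin_cases a <;> fin_cases b <;> simp only [fermiExp, Fin.zero_eta, Fin.mk_one,
    Matrix.cons_val_zero, Matrix.cons_val_one, h1, h2, Real.cos_neg, Real.cos_pi_div_two]

theorem anticommuteSpacelike_fermi {α : ℝ} (hα : 0 < α) (a b : Fin 2) :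
    AnticommuteSpacelike (fermi α a) (fermi α b) ∧
      AnticommuteSpacelike (fermiAdj α a) (fermi α b) ∧
      AnticommuteSpacelike (fermiAdj α a) (fermiAdj α b) := by
  have h1 := cos_fermiExp_mul hα a b
  have h2 : Real.cos (fermiExp α a 1 * fermiExp α b 0 / 2) = 0 := by
    rw [mul_comm]; exact cos_fermiExp_mul hα b a
  simp only [fermi_eq, fermiAdj_eq]
  refine ⟨anticommuteSpacelike_vertexField _ _ h1 h2, anticommuteSpacelike_vertexField _ _ ?_ ?_,
    anticommuteSpacelike_vertexField _ _ ?_ ?_⟩ <;>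
    simpa only [Pi.neg_apply, neg_mul, mul_neg, neg_neg, neg_div, Real.cos_neg]

/-! ### Field equations -/

theorem hasFDerivAt_vertex (c : Fin 2 → ℝ) (φ : Config) (x : Spacetime) :
    HasFDerivAt (fun y => vertex c y φ) (vertex c x φ • Complex.I •
      ∑ i, (c i : ℂ) • Complex.ofRealCLM.comp (fderiv ℝ (φ.1 i) x)) x := by
  have h1 : ∀ i : Fin 2, HasFDerivAt (fun y => (φ.1 i y : ℂ))
      (Complex.ofRealCLM.comp (fderiv ℝ (φ.1 i) x)) x := fun i =>
    Complex.ofRealCLM.hasFDerivAt.comp x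
      (((contDiff_config φ i).differentiable (by simp)).differentiableAt.hasFDerivAt)
  exact ((HasFDerivAt.fun_sum fun i _ => (h1 i).const_mul (c i : ℂ)).const_mul Complex.I).cexp

/-- The value at `e` of the derivative of `∑ cᵢ φᵢ` at `x`. -/
def phaseDeriv (c : Fin 2 → ℝ) (φ : Config) (x e : Spacetime) : ℂ :=
  ∑ i, (c i : ℂ) * (fderiv ℝ (φ.1 i) x e : ℂ)

theorem fderiv_vertexField (A : ℂ) (c : Fin 2 → ℝ) (φ : Config) (x e : Spacetime) :
    fderiv ℝ (fun y => vertexField A c y φ) x e =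
      Complex.I * phaseDeriv c φ x e * vertexField A c x φ := by
  have := (hasFDerivAt_vertex c φ x).const_mul A
  unfold vertexField
  rw [this.fderiv]
  simp [phaseDeriv]
  ring

theorem differentiable_vertexField (A : ℂ) (c : Fin 2 → ℝ) (φ : Config) :
    Differentiable ℝ (fun y => vertexField A c y φ) := fun x =>
  ((hasFDerivAt_vertex c φ x).const_mul A).differentiableAt

theorem hasLineDerivAt_vertexField (A : ℂ) (c : Fin 2 → ℝ) (φ : Config) (x e : Spacetime) :
    HasLineDerivAt ℝ (fun y => vertexField A c y φ)
      (Complex.I * phaseDeriv c φ x e * vertexField A c x φ) x e := by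
  rw [← fderiv_vertexField]
  exact ((differentiable_vertexField A c φ) x).hasFDerivAt.hasLineDerivAt e

theorem phaseDeriv_dirU (c : Fin 2 → ℝ) {φ : Config} (hφ : OnShell φ) (x : Spacetime) :
    phaseDeriv c φ x dirU = (c 0 + c 1) * dPhi 0 x φ := by
  simp [phaseDeriv, dPhi, (hφ x).1, add_mul]

theorem phaseDeriv_dirV (c : Fin 2 → ℝ) {φ : Config} (hφ : OnShell φ) (x : Spacetime) :
    phaseDeriv c φ x dirV = (c 0 - c 1) * dPhi 1 x φ := by
  simp [phaseDeriv, dPhi, (hφ x).2]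
  ring

theorem phaseDeriv_fermi_zero_dirV (α : ℝ) {φ : Config} (hφ : OnShell φ) (x : Spacetime) :
    phaseDeriv (fermiExp α 0) φ x dirV = (α - Real.pi / α) * dPhi 1 x φ := by
  simp [phaseDeriv_dirV _ hφ, fermiExp]

theorem phaseDeriv_fermi_one_dirU (α : ℝ) {φ : Config} (hφ : OnShell φ) (x : Spacetime) :
    phaseDeriv (fermiExp α 1) φ x dirU = -(α - Real.pi / α) * dPhi 0 x φ := by
  simp only [phaseDeriv_dirU _ hφ, fermiExp, Matrix.cons_val_zero, Matrix.cons_val_one]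
  push_cast
  ring

theorem hasLineDerivAt_fermi (α : ℝ) {φ : Config} (hφ : OnShell φ) (x : Spacetime) :
    HasLineDerivAt ℝ (fun y => fermi α 0 y φ)
        (Complex.I * (α - Real.pi / α) * dPhi 1 x φ * fermi α 0 x φ) x dirV ∧
      HasLineDerivAt ℝ (fun y => fermi α 1 y φ)
        (-Complex.I * (α - Real.pi / α) * dPhi 0 x φ * fermi α 1 x φ) x dirU := by
  constructor
  · have := hasLineDerivAt_vertexField (fermiCoeff 0) (fermiExp α 0) φ x dirV
    rw [← fermi_eq, phaseDeriv_fermi_zero_dirV α hφ] at this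
    convert this using 1
    ring
  · have := hasLineDerivAt_vertexField (fermiCoeff 1) (fermiExp α 1) φ x dirU
    rw [← fermi_eq, phaseDeriv_fermi_one_dirU α hφ] at this
    convert this using 1
    ring

/-- The correctly normalized currents `j_u = -(α/π) ∂_u Φ` and `j_v = (α/π) ∂_v Φ`. -/
def current (α : ℝ) : Fin 2 → Spacetime → Functional :=
  ![fun x φ => -(α / Real.pi) * dPhi 0 x φ, fun x φ => (α / Real.pi) * dPhi 1 x φ]

theorem satisfiesThirring_fermi {α : ℝ} (hα : 0 < α) :
    SatisfiesThirring (Real.pi ^ 2 / α ^ 2 - Real.pi) (fermi α) (current α) := by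
  have hα' : (α : ℂ) ≠ 0 := by exact_mod_cast hα.ne'
  have hpi : (Real.pi : ℂ) ≠ 0 := by exact_mod_cast Real.pi_ne_zero
  intro φ hφ
  have hdiff : ∀ a, Differentiable ℝ (fun x => fermi α a x φ) := fun a => by
    rw [fermi_eq]; exact differentiable_vertexField _ _ φ
  refine ⟨hdiff, fun x => ?_⟩
  have hV := (hdiff 0 x).hasFDerivAt.hasLineDerivAt dirV |>.unique (hasLineDerivAt_fermi α hφ x).1
  have hU := (hdiff 1 x).hasFDerivAt.hasLineDerivAt dirU |>.unique (hasLineDerivAt_fermi α hφ x).2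
  -- in the directions `∂_u`, `∂_v` the Dirac equation decouples into the two field equations
  have e0 : ((1, 0) : Spacetime) = dirU + dirV := by ext <;> norm_num [dirU, dirV]
  have e1 : ((0, 1) : Spacetime) = dirU - dirV := by ext <;> norm_num [dirU, dirV]
  ext k
  fin_cases k <;>
    simp [Fin.sum_univ_two, gamma, gammaLow, diracCurrent, Matrix.mul_apply, e0, e1, hV,
      hU, map_add, map_sub, current] <;>
    field_simp <;> ring_nf <;> simp only [Complex.I_sq] <;> ring

/-! ### Short-distance expansions -/

theorem vertex_mul (c d : Fin 2 → ℝ) (x : Spacetime) (φ : Config) :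
    vertex c x φ * vertex d x φ = vertex (c + d) x φ := by
  simp only [vertex, ← Complex.exp_add, ← mul_add, ← Finset.sum_add_distrib, Pi.add_apply,
    Complex.ofReal_add, add_mul]

/-- A first-order Taylor expansion, divided by a coordinate `w` which dominates the distance. -/
theorem tendsto_taylor_div {x : Spacetime} {S : Set Spacetime} {w w' : Spacetime → ℝ}
    {e e' : Spacetime} {C : ℝ} (hw : ∀ z, z = w z • e + w' z • e')
    (hS : ∀ y ∈ S, w (x - y) ≠ 0 ∧ ‖x - y‖ ≤ C * |w (x - y)|) {G : Spacetime → ℂ}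
    {G' : Spacetime →L[ℝ] ℂ} (hG : HasFDerivAt G G' x) (hG1 : G x = 1) :
    Tendsto (fun y => G y * (2 * Real.pi * Complex.I * (w (x - y) : ℂ))⁻¹ -
        (2 * Real.pi * Complex.I * (w (x - y) : ℂ))⁻¹ -
        ((w' (x - y) / w (x - y) : ℝ) : ℂ) * (-(2 * Real.pi * Complex.I)⁻¹ * G' e'))
      (𝓝[S] x) (𝓝 (-(2 * Real.pi * Complex.I)⁻¹ * G' e)) := by
  have hpi : (2 * Real.pi * Complex.I : ℂ) ≠ 0 := Complex.two_pi_I_ne_zero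
  have ho : (fun y => G y - G x - G' (y - x)) =o[𝓝[S] x] fun y => (w (x - y) : ℂ) := by
    refine (hG.isLittleO.mono nhdsWithin_le_nhds).trans_isBigO ?_
    refine Asymptotics.IsBigO.of_bound C ?_
    filter_upwards [self_mem_nhdsWithin] with y hy
    have := (hS y hy).2
    rw [norm_sub_rev] at this
    simpa using this
  have ht := (ho.tendsto_div_nhds_zero.mul_const (2 * Real.pi * Complex.I)⁻¹).add_const
    (-(2 * Real.pi * Complex.I)⁻¹ * G' e)
  rw [zero_mul, zero_add] at ht
  refine ht.congr' ?_
  filter_upwards [self_mem_nhdsWithin] with y hy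
  have h0 : (w (x - y) : ℂ) ≠ 0 := by exact_mod_cast (hS y hy).1
  have hz : G' (y - x) = -((w (x - y) : ℂ) * G' e + (w' (x - y) : ℂ) * G' e') := by
    rw [← neg_sub x y, map_neg]
    conv_lhs => rw [hw (x - y)]
    simp
  rw [hz, hG1]
  push_cast
  field_simp
  ring

theorem eq_lightcone (z : Spacetime) : z = lcU z • dirU + lcV z • dirV := by
  ext <;> simp [lcU, lcV, dirU, dirV] <;> ring

theorem norm_le_lightcone (z : Spacetime) : ‖z‖ ≤ |lcU z| + |lcV z| := by
  have h1 : z.1 = (lcU z + lcV z) / 2 := by simp [lcU, lcV]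
  have h2 : z.2 = (lcU z - lcV z) / 2 := by simp [lcU, lcV]
  rw [Prod.norm_def, h1, h2]
  simp only [Real.norm_eq_abs, abs_div, abs_two]
  refine max_le ?_ ?_
  · linarith [abs_add_le (lcU z) (lcV z), abs_nonneg (lcU z), abs_nonneg (lcV z)]
  · linarith [abs_sub (lcU z) (lcV z), abs_nonneg (lcU z), abs_nonneg (lcV z)]

theorem expU_neg_self (c : Fin 2 → ℝ) : expU (-c) c = -((c 0 + c 1) ^ 2 / (4 * Real.pi)) := by
  simp only [expU, Pi.neg_apply]; ring

theorem expV_neg_self (c : Fin 2 → ℝ) : expV (-c) c = -((c 0 - c 1) ^ 2 / (4 * Real.pi)) := by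
  simp only [expV, Pi.neg_apply]; ring

theorem conj_fermiCoeff_mul (a b : Fin 2) :
    (starRingEnd ℂ) (fermiCoeff a) * fermiCoeff b =
      (2 * Real.pi : ℂ)⁻¹ * !![1, Complex.I; -Complex.I, 1] a b := by
  have h : (((Real.sqrt (2 * Real.pi))⁻¹ : ℝ) : ℂ) * (((Real.sqrt (2 * Real.pi))⁻¹ : ℝ) : ℂ) =
      (2 * Real.pi : ℂ)⁻¹ := by
    rw [← Complex.ofReal_mul, ← mul_inv, Real.mul_self_sqrt (by positivity)]
    push_cast; ring
  have hI := Complex.I_mul_I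
  fin_cases a <;> fin_cases b <;>
    simp only [fermiCoeff, Fin.zero_eta, Fin.mk_one, Matrix.cons_val_zero, Matrix.cons_val_one,
      Matrix.of_apply, Matrix.cons_val', Matrix.cons_val_fin_one, map_mul, map_neg,
      Complex.conj_I, Complex.conj_ofReal, ← h]
  · linear_combination -((((Real.sqrt (2 * Real.pi))⁻¹ : ℝ) : ℂ) ^ 2) * hI
  all_goals ring

theorem exp_I_half_pi : Complex.exp (Complex.I / 2 * Real.pi) = Complex.I := by
  have : Complex.I / 2 * (Real.pi : ℂ) = Real.pi / 2 * Complex.I := by ring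
  rw [this, Complex.exp_pi_div_two_mul_I]

theorem exp_neg_I_half_pi : Complex.exp (-(Complex.I / 2 * Real.pi)) = -Complex.I := by
  rw [Complex.exp_neg, exp_I_half_pi, Complex.inv_I]

theorem fermiExp_mul (α : ℝ) (hα : 0 < α) :
    (fermiExp α 0 0 : ℂ) * fermiExp α 0 1 = Real.pi ∧
      (fermiExp α 1 0 : ℂ) * fermiExp α 1 1 = -Real.pi := by
  have : (α : ℂ) ≠ 0 := by exact_mod_cast hα.ne'
  constructor <;> simp [fermiExp] <;> field_simp

theorem lorentzSq_ne_zero_iff {z : Spacetime} : lorentzSq z ≠ 0 ↔ lcU z ≠ 0 ∧ lcV z ≠ 0 := by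
  simp [lorentzSq]

/-- The lightcone coordinate `u` for `ψ₊` (index `0`) and `v` for `ψ₋` (index `1`). -/
def lc (a : Fin 2) (z : Spacetime) : ℝ := ![lcU z, lcV z] a

theorem continuous_lc (a : Fin 2) : Continuous (lc a) := by
  fin_cases a
  · exact continuous_lcU
  · exact continuous_lcV

theorem vertexKernel_neg_fermiExp {α : ℝ} (hα : 0 < α) (a : Fin 2) {z : Spacetime}
    (hz : lorentzSq z < 0) :
    ((|lorentzSq z| ^ ((α - Real.pi / α) ^ 2 / (4 * Real.pi)) : ℝ) : ℂ) *
      vertexKernel (-fermiExp α a) (fermiExp α a) 0 z = (Complex.I * lc a z)⁻¹ := by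
  obtain ⟨hu, hv⟩ := lorentzSq_ne_zero_iff.mp hz.ne
  obtain ⟨hm0, hm1⟩ := fermiExp_mul α hα
  have hu' := abs_pos.mpr hu
  have hv' := abs_pos.mpr hv
  set κ := (α - Real.pi / α) ^ 2 / (4 * Real.pi) with hκ
  have hκ1 : (α + Real.pi / α) ^ 2 / (4 * Real.pi) = κ + 1 := by
    rw [hκ]; field_simp; ring
  have h1 : |lorentzSq z| ^ κ * (|lcU z| ^ (-(κ + 1)) * |lcV z| ^ (-κ)) = |lcU z|⁻¹ := by
    rw [lorentzSq, abs_mul, Real.mul_rpow hu'.le hv'.le, neg_add, Real.rpow_add hu',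
      Real.rpow_neg hu'.le, Real.rpow_neg hv'.le, Real.rpow_neg hu'.le, Real.rpow_one]
    field_simp
  have h2 : |lorentzSq z| ^ κ * (|lcU z| ^ (-κ) * |lcV z| ^ (-(κ + 1))) = |lcV z|⁻¹ := by
    rw [lorentzSq, abs_mul, Real.mul_rpow hu'.le hv'.le, neg_add, Real.rpow_add hv',
      Real.rpow_neg hu'.le, Real.rpow_neg hv'.le, Real.rpow_neg hv'.le, Real.rpow_one]
    field_simp
  have e0 : expU (-fermiExp α 0) (fermiExp α 0) = -(κ + 1) ∧
      expV (-fermiExp α 0) (fermiExp α 0) = -κ := by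
    rw [expU_neg_self, expV_neg_self, ← hκ1, hκ]
    simp [fermiExp]
  have e1 : expU (-fermiExp α 1) (fermiExp α 1) = -κ ∧
      expV (-fermiExp α 1) (fermiExp α 1) = -(κ + 1) := by
    rw [expU_neg_self, expV_neg_self, ← hκ1, hκ]
    simp only [fermiExp, Matrix.cons_val_zero, Matrix.cons_val_one]
    constructor <;> ring
  rcases lt_or_gt_of_ne hu with h | h
  · have hvp : 0 < lcV z := by
      unfold lorentzSq at hz
      exact (mul_neg_iff.mp hz).resolve_left (fun h' => absurd h'.1 (not_lt.mpr h.le)) |>.2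
    rw [vertexKernel_zero_of_neg _ _ hz h, ← mul_assoc, ← Complex.ofReal_mul, Pi.neg_apply,
      Complex.ofReal_neg, neg_mul, mul_neg, neg_neg, mul_comm (fermiExp α a 1 : ℂ)]
    fin_cases a
    · simp only [Fin.zero_eta, e0.1, e0.2, h1, hm0, exp_I_half_pi, lc, Matrix.cons_val_zero]
      rw [mul_inv, Complex.inv_I, abs_of_neg h, inv_neg, Complex.ofReal_neg, Complex.ofReal_inv]
      ring
    · simp only [Fin.mk_one, e1.1, e1.2, h2, hm1, mul_neg, exp_neg_I_half_pi, lc,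
        Matrix.cons_val_one, Matrix.cons_val_fin_one]
      rw [mul_inv, Complex.inv_I, abs_of_pos hvp, Complex.ofReal_inv]
      ring
  · have hvn : lcV z < 0 := by
      unfold lorentzSq at hz
      exact (mul_neg_iff.mp hz).resolve_right (fun h' => absurd h'.1 (not_lt.mpr h.le)) |>.2
    rw [vertexKernel_zero_of_pos _ _ hz h, ← mul_assoc, ← Complex.ofReal_mul, Pi.neg_apply,
      Complex.ofReal_neg, neg_mul, mul_neg]
    fin_cases a
    · simp only [Fin.zero_eta, e0.1, e0.2, h1, hm0, exp_neg_I_half_pi, lc, Matrix.cons_val_zero]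
      rw [mul_inv, Complex.inv_I, abs_of_pos h, Complex.ofReal_inv]
      ring
    · simp only [Fin.mk_one, e1.1, e1.2, h2, hm1, mul_neg, neg_neg, exp_I_half_pi, lc,
        Matrix.cons_val_one, Matrix.cons_val_fin_one]
      rw [mul_inv, Complex.inv_I, abs_of_neg hvn, inv_neg, Complex.ofReal_neg, Complex.ofReal_inv]
      ring

/-- The normal products `N(ψ₊* ψ₊)` and `N(ψ₋* ψ₋)`. -/
def normalDensity (α : ℝ) : Fin 2 → Spacetime → Functional :=
  ![fun x φ => -(α / (2 * Real.pi) + 1 / (2 * α)) * dPhi 0 x φ,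
    fun x φ => (α / (2 * Real.pi) + 1 / (2 * α)) * dPhi 1 x φ]

/-- The tangent vectors dual to the coordinates `lc 0`, `lc 1`. -/
def lcDir (a : Fin 2) : Spacetime := ![dirU, dirV] a

theorem eq_lc (a : Fin 2) (z : Spacetime) :
    z = lc a z • lcDir a + lc (1 - a) z • lcDir (1 - a) := by
  fin_cases a
  · exact eq_lightcone z
  · rw [add_comm]; exact eq_lightcone z

theorem norm_sub_le_of_mem_cone {x y : Spacetime} {r : ℝ} (h : y ∈ cone x r) (a : Fin 2) :
    lc a (x - y) ≠ 0 ∧ ‖x - y‖ ≤ (1 + r) * |lc a (x - y)| := by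
  obtain ⟨hs, h1, h2⟩ := h
  have := norm_le_lightcone (x - y)
  fin_cases a
  · refine ⟨hs.lcU_ne_zero, ?_⟩
    simp only [lc, Fin.zero_eta, Matrix.cons_val_zero]
    linarith
  · refine ⟨hs.lcV_ne_zero, ?_⟩
    simp only [lc, Fin.mk_one, Matrix.cons_val_one, Matrix.cons_val_fin_one]
    linarith

theorem vertex_neg_mul_self (c : Fin 2 → ℝ) (x : Spacetime) (φ : Config) :
    vertex (-c) x φ * vertex c x φ = 1 := by
  rw [vertex_mul, neg_add_cancel]
  simp [vertex]

/-- The normal product is the gradient term in the expansion of `exp(i(θ(y) - θ(x)))` along the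
singular lightcone coordinate, `θ` being the phase of `ψₐ`. -/
theorem isNormalDensity_normalDensity {α : ℝ} (hα : 0 < α) (a : Fin 2) :
    IsNormalDensity α a (normalDensity α a) := by
  have hα' : (α : ℂ) ≠ 0 := by exact_mod_cast hα.ne'
  have hpi : (Real.pi : ℂ) ≠ 0 := by exact_mod_cast Real.pi_ne_zero
  intro x
  set c := fermiExp α a with hc
  refine ⟨_, fun y h => by
    rw [fermi_eq, fermiAdj_eq]; exact isStarProduct_vertex _ _ _ _ h, fun φ =>
      -(2 * Real.pi * Complex.I)⁻¹ * (Complex.I * phaseDeriv c φ x (lcDir (1 - a))),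
      fun φ hφ r => ?_⟩
  have hG := (hasFDerivAt_vertex c φ x).const_mul (vertex (-c) x φ)
  have ht := tendsto_taylor_div (S := cone x r) (C := 1 + r) (eq_lc a)
    (fun y hy => norm_sub_le_of_mem_cone hy a) hG (vertex_neg_mul_self c x φ)
  have hG' : ∀ e, (vertex (-c) x φ • vertex c x φ • Complex.I •
      ∑ i, (c i : ℂ) • Complex.ofRealCLM.comp (fderiv ℝ (φ.1 i) x)) e =
      Complex.I * phaseDeriv c φ x e := by
    intro e
    rw [← mul_smul, vertex_neg_mul_self]
    simp [phaseDeriv, mul_add]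
  rw [hG', hG'] at ht
  have hN : -(2 * Real.pi * Complex.I)⁻¹ * (Complex.I * phaseDeriv c φ x (lcDir a)) =
      normalDensity α a x φ := by
    rw [hc]
    fin_cases a
    · simp only [Fin.zero_eta, lcDir, Matrix.cons_val_zero, phaseDeriv_dirU _ hφ, normalDensity,
        fermiExp, Matrix.cons_val_one]
      push_cast
      field_simp
    · simp only [Fin.mk_one, lcDir, Matrix.cons_val_one, phaseDeriv_dirV _ hφ, normalDensity,
        fermiExp, Matrix.cons_val_zero]
      push_cast
      field_simp
      ring
  rw [hN] at ht
  refine ht.congr' ?_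
  filter_upwards [self_mem_nhdsWithin] with y hy
  have hk := vertexKernel_neg_fermiExp hα a hy.1
  have h11 : !![1, Complex.I; -Complex.I, 1] a a = (1 : ℂ) := by fin_cases a <;> rfl
  rw [conj_fermiCoeff_mul, h11, mul_one]
  -- after cancelling the power of `|(x - y)²|` only the pole `1 / (iw)` is left of the kernel
  have hl : (![lcU (x - y), lcV (x - y)] a : ℝ) = lc a (x - y) := by fin_cases a <;> rfl
  have hl' : (![lcV (x - y) / lcU (x - y), lcU (x - y) / lcV (x - y)] a : ℝ) =
      lc (1 - a) (x - y) / lc a (x - y) := by fin_cases a <;> rfl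
  rw [hl, hl']
  congr 2
  rw [← hc] at hk ⊢
  calc _ = vertex (-c) x φ * vertex c y φ * ((2 * Real.pi : ℂ)⁻¹ * (Complex.I * lc a (x - y))⁻¹) := by
        rw [← mul_inv]; ring_nf
    _ = _ := by rw [← hk]; ring

/-- In the mixed products both wedges produce the same phase and the same power of the Lorentz
square. -/
theorem vertexKernel_mixed {α : ℝ} (hα : 0 < α) {a b : Fin 2} (hab : a ≠ b) {z : Spacetime}
    (hz : lorentzSq z < 0) :
    ((|lorentzSq z| ^ (-(α ^ 2 / (4 * Real.pi) - Real.pi / (4 * α ^ 2))) : ℝ) : ℂ) *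
      vertexKernel (-fermiExp α a) (fermiExp α b) 0 z = ![-Complex.I, Complex.I] a := by
  obtain ⟨hu, hv⟩ := lorentzSq_ne_zero_iff.mp hz.ne
  have hα' : (α : ℂ) ≠ 0 := by exact_mod_cast hα.ne'
  have hu' := abs_pos.mpr hu
  have hv' := abs_pos.mpr hv
  set κ := α ^ 2 / (4 * Real.pi) - Real.pi / (4 * α ^ 2) with hκ
  have h1 : |lorentzSq z| ^ (-κ) * (|lcU z| ^ κ * |lcV z| ^ κ) = 1 := by
    rw [lorentzSq, abs_mul, ← Real.mul_rpow hu'.le hv'.le, ← Real.rpow_add (mul_pos hu' hv')]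
    simp
  have hexp : expU (-fermiExp α a) (fermiExp α b) = κ ∧
      expV (-fermiExp α a) (fermiExp α b) = κ := by
    fin_cases a <;> fin_cases b <;> simp at hab <;>
      simp only [expU, expV, hκ, fermiExp, Fin.zero_eta, Fin.mk_one, Matrix.cons_val_zero,
        Matrix.cons_val_one, Pi.neg_apply] <;>
      constructor <;> field_simp <;> ring
  have hphase : Complex.exp (Complex.I / 2 * ((-fermiExp α a) 0 * fermiExp α b 1)) =
        ![-Complex.I, Complex.I] a ∧
      Complex.exp (-(Complex.I / 2 * ((-fermiExp α a) 1 * fermiExp α b 0))) =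
        ![-Complex.I, Complex.I] a := by
    have e : (α : ℂ) * (Real.pi / α) = Real.pi := by field_simp
    have e' : (Real.pi / α : ℂ) * α = Real.pi := by field_simp
    fin_cases a <;> fin_cases b <;> simp at hab <;>
      simp only [fermiExp, Fin.zero_eta, Fin.mk_one, Matrix.cons_val_zero,
        Matrix.cons_val_one, Pi.neg_apply, Complex.ofReal_neg, Complex.ofReal_div, neg_mul, mul_neg,
        neg_neg, e, e', exp_I_half_pi, exp_neg_I_half_pi, and_self]
  rcases lt_or_gt_of_ne hu with h | h
  · rw [vertexKernel_zero_of_neg _ _ hz h, ← mul_assoc, ← Complex.ofReal_mul, hexp.1, hexp.2, h1,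
      hphase.2, Complex.ofReal_one, one_mul]
  · rw [vertexKernel_zero_of_pos _ _ hz h, ← mul_assoc, ← Complex.ofReal_mul, hexp.1, hexp.2, h1,
      hphase.1, Complex.ofReal_one, one_mul]

/-- After multiplication by the power of `|(x - y)²|` the kernels of the two mixed products are
constants, so the limit is the value of the symbols at coinciding points. -/
theorem isMassTerm_cosField {α : ℝ} (hα : 0 < α) :
    IsMassTerm α (fun x φ => (Real.pi : ℂ)⁻¹ * cosField (2 * α) x φ) := by
  intro x
  refine ⟨_, fun a b y h => by
    rw [fermi_eq, fermiAdj_eq]; exact isStarProduct_vertex _ _ _ _ h, fun φ => ?_⟩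
  have hα' : (α : ℂ) ≠ 0 := by exact_mod_cast hα.ne'
  have hcont : Continuous fun y => (2 * Real.pi : ℂ)⁻¹ *
      (vertex (-fermiExp α 0) x φ * vertex (fermiExp α 1) y φ +
        vertex (-fermiExp α 1) x φ * vertex (fermiExp α 0) y φ) := by
    have h0 := continuous_vertex (fermiExp α 0) φ
    have h1 := continuous_vertex (fermiExp α 1) φ
    fun_prop
  -- at coinciding points the dual field drops out and the two exponents `∓2αΦ` add up to a cosine
  have hlim : (2 * Real.pi : ℂ)⁻¹ *
      (vertex (-fermiExp α 0) x φ * vertex (fermiExp α 1) x φ +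
        vertex (-fermiExp α 1) x φ * vertex (fermiExp α 0) x φ) =
      (Real.pi : ℂ)⁻¹ * cosField (2 * α) x φ := by
    have h1 : vertex (-fermiExp α 0 + fermiExp α 1) x φ =
        Complex.exp (-(((2 * α * φ.1 0 x : ℝ) : ℂ)) * Complex.I) := by
      unfold vertex
      congr 1
      simp [fermiExp, Fin.sum_univ_two]
      ring
    have h2 : vertex (-fermiExp α 1 + fermiExp α 0) x φ =
        Complex.exp (((2 * α * φ.1 0 x : ℝ) : ℂ) * Complex.I) := by
      unfold vertex
      congr 1
      simp [fermiExp, Fin.sum_univ_two]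
      ring
    rw [vertex_mul, vertex_mul, h1, h2, add_comm, ← Complex.two_cos, cosField, Complex.ofReal_cos,
      mul_inv]
    ring
  have ht := (hcont.tendsto x).mono_left (nhdsWithin_le_nhds (s := {y | Spacelike x y}))
  rw [hlim] at ht
  refine ht.congr' ?_
  filter_upwards [self_mem_nhdsWithin] with y hy
  have k0 := vertexKernel_mixed hα (a := 0) (b := 1) (by simp) hy
  have k1 := vertexKernel_mixed hα (a := 1) (b := 0) (by simp) hy
  have hI := Complex.I_mul_I
  simp only [Fin.sum_univ_two, gamma, conj_fermiCoeff_mul, Matrix.cons_val_zero,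
    Matrix.cons_val_one, Matrix.of_apply, Matrix.cons_val', Matrix.cons_val_fin_one, zero_mul,
    one_mul, zero_add, add_zero] at k0 k1 ⊢
  linear_combination
    (-(2 * Real.pi : ℂ)⁻¹ * Complex.I * vertex (-fermiExp α 0) x φ * vertex (fermiExp α 1) y φ) * k0 +
    ((2 * Real.pi : ℂ)⁻¹ * Complex.I * vertex (-fermiExp α 1) x φ * vertex (fermiExp α 0) y φ) * k1 +
    ((2 * Real.pi : ℂ)⁻¹ * (vertex (-fermiExp α 0) x φ * vertex (fermiExp α 1) y φ +
        vertex (-fermiExp α 1) x φ * vertex (fermiExp α 0) y φ)) * hI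

/-! ### Logarithmic potentials on the line -/

/-- The logarithmic potential `r ↦ ∫ b(s) ln(iσ(r - s) + ε) ds`; only `σ = 1` and `σ = -1` are
used. -/
def logConv (σ ε : ℝ) (b : ℝ → ℂ) (r : ℝ) : ℂ :=
  ∫ s, b s * Complex.log (Complex.I * (σ * (r - s) : ℝ) + ε)

/-- A locally integrable bound for `ln(±iw + ε)`, uniform in `0 ≤ ε ≤ 1`. -/
def logBound (w : ℝ) : ℝ := |Real.log w| + (|w| + Real.pi)

theorem logBound_nonneg (w : ℝ) : 0 ≤ logBound w := by
  unfold logBound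
  have := Real.pi_pos
  positivity

theorem norm_log_le_logBound {σ ε w : ℝ} (hσ : |σ| = 1) (h0 : 0 ≤ ε) (h1 : ε ≤ 1) (hw : w ≠ 0) :
    ‖Complex.log (Complex.I * (σ * w : ℝ) + ε)‖ ≤ logBound w := by
  set z : ℂ := Complex.I * (σ * w : ℝ) + ε with hz
  have him : z.im = σ * w := by simp [hz]
  -- `|w| ≤ ‖z‖ ≤ |w| + 1`, so `ln ‖z‖` lies between `ln |w|` and `|w|`
  have hlow : |w| ≤ ‖z‖ := by
    have := Complex.abs_im_le_norm z
    rwa [him, abs_mul, hσ, one_mul] at this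
  have hup : ‖z‖ ≤ |w| + 1 := by
    refine (norm_add_le _ _).trans ?_
    have e1 : ‖Complex.I * ((σ * w : ℝ) : ℂ)‖ = |w| := by
      rw [norm_mul, Complex.norm_I, one_mul, Complex.norm_real, Real.norm_eq_abs, abs_mul, hσ,
        one_mul]
    have e2 : ‖(ε : ℂ)‖ ≤ 1 := by
      rw [Complex.norm_real, Real.norm_eq_abs, abs_of_nonneg h0]; exact h1
    linarith
  have hw' := abs_pos.mpr hw
  have hlog1 : Real.log w ≤ Real.log ‖z‖ := by
    rw [← Real.log_abs w]; exact Real.log_le_log hw' hlow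
  have hlog2 : Real.log ‖z‖ ≤ |w| := by
    have := Real.log_le_sub_one_of_pos (x := ‖z‖) (hw'.trans_le hlow)
    linarith
  have hre : |(Complex.log z).re| ≤ |Real.log w| + |w| := by
    rw [Complex.log_re, abs_le]
    constructor
    · linarith [neg_abs_le (Real.log w)]
    · linarith [abs_nonneg (Real.log w)]
  have him' : |(Complex.log z).im| ≤ Real.pi := by
    rw [Complex.log_im]; exact Complex.abs_arg_le_pi z
  have := Complex.norm_le_abs_re_add_abs_im (Complex.log z)
  unfold logBound
  linarith

theorem locallyIntegrable_abs_log : LocallyIntegrable fun w : ℝ => |Real.log w| := by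
  intro x
  refine ⟨Set.Ioc (x - 1) (x + 1), Ioc_mem_nhds (by linarith) (by linarith), ?_⟩
  exact Integrable.abs ((intervalIntegrable_iff_integrableOn_Ioc_of_le (by linarith)).mp
    intervalIntegral.intervalIntegrable_log')

theorem locallyIntegrable_logBound : LocallyIntegrable logBound := by
  have h : Continuous fun w : ℝ => |w| + Real.pi := by fun_prop
  exact locallyIntegrable_abs_log.add h.locallyIntegrable

theorem continuous_log_line (σ : ℝ) {ε : ℝ} (hε : 0 < ε) :
    Continuous fun w : ℝ => Complex.log (Complex.I * (σ * w : ℝ) + ε) := by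
  refine Continuous.clog (by fun_prop) fun w => ofReal_mul_I_add_mem_slitPlane _ hε

/-- The bound for `logConv` obtained from `logBound`. -/
def logMajor (b : ℝ → ℂ) (r : ℝ) : ℝ := ∫ s, ‖b s‖ * logBound (r - s)

theorem continuous_logMajor {b : ℝ → ℂ} (hb : Continuous b) (hbs : HasCompactSupport b) :
    Continuous (logMajor b) :=
  hbs.norm.continuous_convolution_left (ContinuousLinearMap.mul ℝ ℝ) hb.norm
    locallyIntegrable_logBound

theorem integrable_mul_logBound {b : ℝ → ℂ} (hb : Continuous b) (hbs : HasCompactSupport b)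
    (r : ℝ) : Integrable fun s => ‖b s‖ * logBound (r - s) :=
  hbs.norm.convolutionExists_left (ContinuousLinearMap.mul ℝ ℝ) hb.norm
    locallyIntegrable_logBound r

theorem ae_norm_mul_log_le {σ ε : ℝ} (hσ : |σ| = 1) (h0 : 0 ≤ ε) (h1 : ε ≤ 1) (b : ℝ → ℂ) (r : ℝ) :
    ∀ᵐ s, ‖b s * Complex.log (Complex.I * (σ * (r - s) : ℝ) + ε)‖ ≤ ‖b s‖ * logBound (r - s) := by
  filter_upwards [compl_mem_ae_iff.mpr (measure_singleton (μ := (volume : Measure ℝ)) r)] with s hs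
  rw [norm_mul]
  exact mul_le_mul_of_nonneg_left
    (norm_log_le_logBound hσ h0 h1 (sub_ne_zero.mpr (Ne.symm hs))) (norm_nonneg _)

theorem norm_logConv_le {σ ε : ℝ} (hσ : |σ| = 1) (h0 : 0 ≤ ε) (h1 : ε ≤ 1) {b : ℝ → ℂ}
    (hb : Continuous b) (hbs : HasCompactSupport b) (r : ℝ) :
    ‖logConv σ ε b r‖ ≤ logMajor b r :=
  norm_integral_le_of_norm_le (integrable_mul_logBound hb hbs r) (ae_norm_mul_log_le hσ h0 h1 b r)

theorem measurable_log_line (σ ε : ℝ) :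
    Measurable fun w : ℝ => Complex.log (Complex.I * (σ * w : ℝ) + ε) := by
  fun_prop

theorem continuous_logConv {σ ε : ℝ} (hσ : |σ| = 1) (h0 : 0 ≤ ε) (h1 : ε ≤ 1) {b : ℝ → ℂ}
    (hb : Continuous b) (hbs : HasCompactSupport b) : Continuous (logConv σ ε b) := by
  refine hbs.continuous_convolution_left (ContinuousLinearMap.mul ℝ ℂ) hb
    (locallyIntegrable_logBound.mono (measurable_log_line σ ε).aestronglyMeasurable ?_)
  filter_upwards [compl_mem_ae_iff.mpr (measure_singleton (μ := (volume : Measure ℝ)) 0)] with w hw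
  rw [Real.norm_of_nonneg (logBound_nonneg w)]
  exact norm_log_le_logBound hσ h0 h1 hw

theorem integrable_mul_log_line {σ ε : ℝ} (hσ : |σ| = 1) (h0 : 0 ≤ ε) (h1 : ε ≤ 1) {b : ℝ → ℂ}
    (hb : Continuous b) (hbs : HasCompactSupport b) (r : ℝ) :
    Integrable fun s => b s * Complex.log (Complex.I * (σ * (r - s) : ℝ) + ε) := by
  refine (integrable_mul_logBound hb hbs r).mono' (hb.aestronglyMeasurable.mul ?_)
    (ae_norm_mul_log_le hσ h0 h1 b r)
  exact ((measurable_log_line σ ε).comp (measurable_const.sub measurable_id)).aestronglyMeasurable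

theorem tendsto_logConv {σ : ℝ} (hσ : |σ| = 1) {b : ℝ → ℂ} (hb : Continuous b)
    (hbs : HasCompactSupport b) (r : ℝ) :
    Tendsto (fun ε => logConv σ ε b r) (𝓝[>] 0) (𝓝 (logConv σ 0 b r)) := by
  refine tendsto_integral_filter_of_dominated_convergence (fun s => ‖b s‖ * logBound (r - s))
    ?_ ?_ (integrable_mul_logBound hb hbs r) ?_
  · filter_upwards [Ioc_mem_nhdsGT (zero_lt_one' ℝ)] with ε hε
    exact (integrable_mul_log_line hσ hε.1.le hε.2 hb hbs r).aestronglyMeasurable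
  · filter_upwards [Ioc_mem_nhdsGT (zero_lt_one' ℝ)] with ε hε
    exact ae_norm_mul_log_le hσ hε.1.le hε.2 b r
  · filter_upwards [compl_mem_ae_iff.mpr (measure_singleton (μ := (volume : Measure ℝ)) r)] with s hs
    have hne : σ * (r - s) ≠ 0 :=
      mul_ne_zero (by rintro rfl; simp at hσ) (sub_ne_zero.mpr (Ne.symm hs))
    have hc : ContinuousAt (fun ε : ℝ => Complex.log (Complex.I * (σ * (r - s) : ℝ) + ε)) 0 := by
      refine ContinuousAt.clog (by fun_prop) ?_
      right
      simpa using hne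
    exact (hc.tendsto.mono_left nhdsWithin_le_nhds).const_mul _

/-- Weak convergence of the logarithmic potentials as `ε ↓ 0`. -/
theorem tendsto_integral_logConv {X : Type*} [TopologicalSpace X] [MeasurableSpace X]
    [OpensMeasurableSpace X] {μ : Measure X} [IsFiniteMeasureOnCompacts μ] {σ : ℝ} (hσ : |σ| = 1)
    {b : ℝ → ℂ} (hb : Continuous b) (hbs : HasCompactSupport b) {F : X → ℂ} (hF : Continuous F)
    (hFs : HasCompactSupport F) {ρ : X → ℝ} (hρ : Continuous ρ) :
    Tendsto (fun ε => ∫ x, F x * logConv σ ε b (ρ x) ∂μ) (𝓝[>] 0)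
      (𝓝 (∫ x, F x * logConv σ 0 b (ρ x) ∂μ)) := by
  refine tendsto_integral_filter_of_dominated_convergence (fun x => ‖F x‖ * logMajor b (ρ x))
    ?_ ?_ ?_ (ae_of_all _ fun x => (tendsto_logConv hσ hb hbs _).const_mul _)
  · filter_upwards [Ioc_mem_nhdsGT (zero_lt_one' ℝ)] with ε hε
    have : Continuous fun x => F x * logConv σ ε b (ρ x) :=
      hF.mul ((continuous_logConv hσ hε.1.le hε.2 hb hbs).comp hρ)
    exact (this.integrable_of_hasCompactSupport hFs.mul_right).aestronglyMeasurable
  · filter_upwards [Ioc_mem_nhdsGT (zero_lt_one' ℝ)] with ε hε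
    refine ae_of_all _ fun x => ?_
    rw [norm_mul]
    exact mul_le_mul_of_nonneg_left (norm_logConv_le hσ hε.1.le hε.2 hb hbs _) (norm_nonneg _)
  · exact Continuous.integrable_of_hasCompactSupport
      (hF.norm.mul ((continuous_logMajor hb hbs).comp hρ)) hFs.norm.mul_right

/-- The jump of the logarithm: `ln(iw) - ln(-iw) = iπ sgn w`, whose derivative is `2πi δ(w)`. -/
theorem logConv_sub_logConv {β : ℝ → ℂ} (hβ : ContDiff ℝ 1 β) (hβs : HasCompactSupport β) (r : ℝ) :
    logConv 1 0 (deriv β) r - logConv (-1) 0 (deriv β) r = 2 * Real.pi * Complex.I * β r := by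
  have hb : Continuous (deriv β) := hβ.continuous_deriv le_rfl
  have hbs : HasCompactSupport (deriv β) := hβs.deriv
  have i1 := integrable_mul_log_line (σ := 1) (by simp) le_rfl zero_le_one hb hbs r
  have i2 := integrable_mul_log_line (σ := -1) (by simp) le_rfl zero_le_one hb hbs r
  unfold logConv
  have hsplit := intervalIntegral.integral_Iic_add_Ioi (b := r)
    (i1.sub i2).integrableOn (i1.sub i2).integrableOn
  simp only [Pi.sub_apply] at hsplit
  rw [← integral_sub i1 i2, ← hsplit]
  -- the difference of the logarithms is `iπ` for `s < r` and `-iπ` for `s > r`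
  have e1 : ∫ s in Set.Iic r, (deriv β s * Complex.log (Complex.I * (1 * (r - s) : ℝ) + (0 : ℝ)) -
      deriv β s * Complex.log (Complex.I * (-1 * (r - s) : ℝ) + (0 : ℝ))) =
      ∫ s in Set.Iic r, (Real.pi * Complex.I) * deriv β s := by
    rw [integral_Iic_eq_integral_Iio, integral_Iic_eq_integral_Iio]
    refine setIntegral_congr_fun measurableSet_Iio fun s hs => ?_
    have hs' : 0 < r - s := sub_pos.mpr hs
    simp only [Complex.ofReal_zero, add_zero]
    rw [log_I_mul_of_pos (by linarith), log_I_mul_of_neg (by linarith), one_mul, neg_one_mul,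
      abs_neg]
    ring
  have e2 : ∫ s in Set.Ioi r, (deriv β s * Complex.log (Complex.I * (1 * (r - s) : ℝ) + (0 : ℝ)) -
      deriv β s * Complex.log (Complex.I * (-1 * (r - s) : ℝ) + (0 : ℝ))) =
      ∫ s in Set.Ioi r, -(Real.pi * Complex.I) * deriv β s := by
    refine setIntegral_congr_fun measurableSet_Ioi fun s hs => ?_
    have hs' : r - s < 0 := sub_neg.mpr hs
    simp only [Complex.ofReal_zero, add_zero]
    rw [log_I_mul_of_neg (by linarith), log_I_mul_of_pos (by linarith), one_mul, neg_one_mul,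
      abs_neg]
    ring
  rw [e1, e2, integral_const_mul, integral_const_mul, hβs.integral_Iic_deriv_eq hβ,
    hβs.integral_Ioi_deriv_eq hβ]
  ring

/-- Integration by parts against `1 / (iσ(r - s) + ε) = (d/ds) iσ ln(iσ(r - s) + ε)`. -/
theorem integral_mul_inv_eq_logConv {σ ε : ℝ} (hσ : σ * σ = 1) (hε : 0 < ε) {β : ℝ → ℂ}
    (hβ : ContDiff ℝ 1 β) (hβs : HasCompactSupport β) (r : ℝ) :
    ∫ s, β s * (Complex.I * (σ * (r - s) : ℝ) + ε)⁻¹ =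
      -(Complex.I * σ) * logConv σ ε (deriv β) r := by
  have hb : Continuous (deriv β) := hβ.continuous_deriv le_rfl
  have hmem : ∀ s : ℝ, Complex.I * ((σ * (r - s) : ℝ) : ℂ) + ε ∈ Complex.slitPlane := fun s =>
    ofReal_mul_I_add_mem_slitPlane _ hε
  have hv : ∀ s : ℝ, HasDerivAt
      (fun s : ℝ => Complex.I * σ * Complex.log (Complex.I * (σ * (r - s) : ℝ) + ε))
      ((Complex.I * (σ * (r - s) : ℝ) + ε)⁻¹) s := by
    intro s
    have h1 : HasDerivAt (fun s : ℝ => σ * (r - s)) (σ * -1) s :=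
      ((hasDerivAt_id s).const_sub r).const_mul σ
    have h2 := ((h1.ofReal_comp.const_mul Complex.I).add_const (ε : ℂ)).clog_real (hmem s)
    refine (h2.const_mul (Complex.I * σ)).congr_deriv ?_
    have hσ' : (σ : ℂ) * σ = 1 := by exact_mod_cast hσ
    have hI := Complex.I_mul_I
    push_cast
    rw [div_eq_mul_inv]
    linear_combination (-(σ : ℂ) * σ * (Complex.I * (σ * (r - s)) + ε)⁻¹) * hI +
      (Complex.I * (σ * (r - s)) + ε : ℂ)⁻¹ * hσ'
  have hlog : Continuous fun s : ℝ =>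
      Complex.I * σ * Complex.log (Complex.I * (σ * (r - s) : ℝ) + ε) :=
    continuous_const.mul ((continuous_log_line σ hε).comp (continuous_const.sub continuous_id))
  have hinv : Continuous fun s : ℝ => (Complex.I * ((σ * (r - s) : ℝ) : ℂ) + ε)⁻¹ :=
    Continuous.inv₀ (by fun_prop) fun s => Complex.slitPlane_ne_zero (hmem s)
  have key := integral_mul_deriv_eq_deriv_mul_of_integrable (u := β) (u' := deriv β)
    (fun s _ => (hβ.differentiable one_ne_zero s).hasDerivAt) (fun s _ => hv s)
    ((hβ.continuous.mul hinv).integrable_of_hasCompactSupport hβs.mul_right)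
    ((hb.mul hlog).integrable_of_hasCompactSupport hβs.deriv.mul_right)
    ((hβ.continuous.mul hlog).integrable_of_hasCompactSupport hβs.mul_right)
  rw [key, logConv, ← integral_const_mul, ← integral_neg]
  congr 1; ext s
  ring

/-! ### Integration in lightcone coordinates -/

/-- The point with `lc a = s`, the other lightcone coordinate being `t`. -/
def lcPoint (a : Fin 2) (s t : ℝ) : Spacetime := ![ofLightcone s t, ofLightcone t s] a

theorem lc_lcPoint (a : Fin 2) (s t : ℝ) : lc a (lcPoint a s t) = s := by
  fin_cases a <;> simp [lc, lcPoint, lcU, lcV, ofLightcone] <;> ring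

theorem lc_lcPoint' (a : Fin 2) (s t : ℝ) : lc (1 - a) (lcPoint a s t) = t := by
  fin_cases a <;> simp [lc, lcPoint, lcU, lcV, ofLightcone] <;> ring

theorem contDiff_lcPoint (a : Fin 2) :
    ContDiff ℝ ∞ fun p : ℝ × ℝ => lcPoint a p.1 p.2 := by
  fin_cases a <;> simp only [lcPoint, ofLightcone, Fin.zero_eta, Fin.mk_one, Matrix.cons_val_zero,
    Matrix.cons_val_one, Matrix.cons_val_fin_one] <;> fun_prop

theorem abs_lc_le (a : Fin 2) (z : Spacetime) : |lc a z| ≤ 2 * ‖z‖ := by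
  have h1 : |z.1| ≤ ‖z‖ := norm_fst_le z
  have h2 : |z.2| ≤ ‖z‖ := norm_snd_le z
  fin_cases a <;> simp only [lc, lcU, lcV, Fin.zero_eta, Fin.mk_one, Matrix.cons_val_zero,
    Matrix.cons_val_one, Matrix.cons_val_fin_one]
  · linarith [abs_add_le z.1 z.2]
  · linarith [abs_sub z.1 z.2]

theorem exists_lcPoint_eq_zero {F : Spacetime → ℂ} (hF : HasCompactSupport F) (a : Fin 2) :
    ∃ M, ∀ s t, M < |s| ∨ M < |t| → F (lcPoint a s t) = 0 := by
  obtain ⟨R, hR⟩ := hF.isCompact.isBounded.subset_closedBall (0 : Spacetime)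
  refine ⟨2 * R, fun s t h => ?_⟩
  by_contra hne
  have hb := hR (subset_tsupport F hne)
  rw [mem_closedBall_zero_iff] at hb
  have h1 := abs_lc_le a (lcPoint a s t)
  have h2 := abs_lc_le (1 - a) (lcPoint a s t)
  rw [lc_lcPoint] at h1
  rw [lc_lcPoint'] at h2
  rcases h with h | h <;> linarith

theorem hasCompactSupport_comp_lcPoint {F : Spacetime → ℂ} (hF : HasCompactSupport F) (a : Fin 2) :
    HasCompactSupport fun p : ℝ × ℝ => F (lcPoint a p.1 p.2) := by
  obtain ⟨M, hM⟩ := exists_lcPoint_eq_zero hF a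
  refine HasCompactSupport.of_support_subset_isCompact (isCompact_closedBall (0 : ℝ × ℝ) M)
    fun p hp => ?_
  rw [mem_closedBall_zero_iff]
  by_contra hlt
  rw [not_le, Prod.norm_def, lt_max_iff] at hlt
  exact hp (hM p.1 p.2 hlt)

/-- The integral of `F` over the line `lc a = s`, with the measure for which `dx` is the product
with `ds`. -/
def fiberInt (a : Fin 2) (F : Spacetime → ℂ) (s : ℝ) : ℂ := 1 / 2 * ∫ t, F (lcPoint a s t)

theorem integral_eq_integral_ofLightcone {F : Spacetime → ℂ} (hF : Continuous F) :
    ∫ x, F x = 1 / 2 * ∫ p : ℝ × ℝ, F (ofLightcone p.1 p.2) := by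
  -- the change to lightcone coordinates is linear with Jacobian `1/2`
  set L : ℝ × ℝ →ₗ[ℝ] ℝ × ℝ := Matrix.toLin (Module.Basis.finTwoProd ℝ) (Module.Basis.finTwoProd ℝ)
    !![1 / 2, 1 / 2; 1 / 2, -1 / 2] with hL
  have hdet : LinearMap.det L = -1 / 2 := by
    rw [hL, LinearMap.det_toLin, Matrix.det_fin_two_of]; norm_num
  have hLa : ∀ p : ℝ × ℝ, L p = ofLightcone p.1 p.2 := by
    intro p
    rw [hL, Matrix.toLin_finTwoProd_apply, ofLightcone]
    ext <;> simp <;> ring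
  have hmap := Measure.map_linearMap_addHaar_eq_smul_addHaar (volume : Measure (ℝ × ℝ)) (f := L)
    (by rw [hdet]; norm_num)
  have h1 : ∫ p, F (L p) = ∫ x, F x ∂(Measure.map L volume) := by
    rw [integral_map L.continuous_of_finiteDimensional.aemeasurable hF.aestronglyMeasurable]
  simp only [hLa] at h1
  rw [h1, hmap, integral_smul_measure, hdet]
  norm_num
  ring

theorem integral_eq_integral_fiberInt {F : Spacetime → ℂ} (hF : Continuous F)
    (hFs : HasCompactSupport F) (a : Fin 2) : ∫ x, F x = ∫ s, fiberInt a F s := by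
  have hint : ∀ a, Integrable fun p : ℝ × ℝ => F (lcPoint a p.1 p.2) := fun a =>
    (hF.comp (contDiff_lcPoint a).continuous).integrable_of_hasCompactSupport
      (hasCompactSupport_comp_lcPoint hFs a)
  have h0 : ∫ x, F x = ∫ s, fiberInt 0 F s := by
    unfold fiberInt
    rw [integral_const_mul, integral_eq_integral_ofLightcone hF]
    congr 1
    exact integral_prod (f := fun p : ℝ × ℝ => F (lcPoint 0 p.1 p.2)) (hint 0)
  rw [h0]
  fin_cases a
  · rfl
  · unfold fiberInt
    rw [integral_const_mul, integral_const_mul]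
    congr 1
    exact integral_integral_swap (f := fun s t => F (lcPoint 0 s t)) (hint 0)

theorem fiberInt_mul_lc (a : Fin 2) (F : Spacetime → ℂ) (h : ℝ → ℂ) (s : ℝ) :
    fiberInt a (fun x => F x * h (lc a x)) s = fiberInt a F s * h s := by
  unfold fiberInt
  simp only [lc_lcPoint, integral_mul_const, mul_assoc]

theorem integral_mul_comp_lc {F : Spacetime → ℂ} (hF : Continuous F) (hFs : HasCompactSupport F)
    (a : Fin 2) {h : ℝ → ℂ} (hh : Continuous h) :
    ∫ x, F x * h (lc a x) = ∫ s, fiberInt a F s * h s := by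
  rw [integral_eq_integral_fiberInt (F := fun x => F x * h (lc a x))
    (hF.mul (hh.comp (continuous_lc a))) hFs.mul_right a]
  simp only [fiberInt_mul_lc]

theorem hasCompactSupport_fiberInt {F : Spacetime → ℂ} (hFs : HasCompactSupport F) (a : Fin 2) :
    HasCompactSupport (fiberInt a F) := by
  obtain ⟨M, hM⟩ := exists_lcPoint_eq_zero hFs a
  refine HasCompactSupport.of_support_subset_isCompact (isCompact_closedBall (0 : ℝ) M)
    fun s hs => ?_
  rw [mem_closedBall_zero_iff]
  by_contra hlt
  refine hs ?_
  have : ∀ t, F (lcPoint a s t) = 0 := fun t => hM s t (Or.inl (not_le.mp hlt))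
  simp [fiberInt, this]

theorem contDiff_fiberInt {F : Spacetime → ℂ} (hF : ContDiff ℝ ∞ F) (hFs : HasCompactSupport F)
    (a : Fin 2) : ContDiff ℝ 1 (fiberInt a F) := by
  obtain ⟨M, hM⟩ := exists_lcPoint_eq_zero hFs a
  -- the fibre integral is the convolution of `t ↦ F (lcPoint a s t)` with the constant `1`
  have := contDiffOn_convolution_left_with_param_comp (μ := (volume : Measure ℝ)) (n := 1)
    (ContinuousLinearMap.mul ℝ ℂ) (s := (Set.univ : Set ℝ)) (v := fun _ => (0 : ℝ))
    contDiffOn_const (f := fun _ : ℝ => (1 : ℂ)) (g := fun s t => F (lcPoint a s t))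
    (k := Metric.closedBall 0 M) isOpen_univ (isCompact_closedBall 0 M)
    (fun s t _ ht => hM s t (Or.inr (by simpa using ht)))
    (continuous_const.locallyIntegrable)
    (((hF.comp (contDiff_lcPoint a)).of_le (by simp)).contDiffOn)
  rw [contDiffOn_univ] at this
  simp only [convolution, ContinuousLinearMap.mul_apply', mul_one] at this
  exact contDiff_const.mul this

/-! ### Free chiral Fermi fields -/

theorem fermiExp_sqrt_pi : fermiExp (Real.sqrt Real.pi) =
    ![![Real.sqrt Real.pi, Real.sqrt Real.pi], ![-Real.sqrt Real.pi, Real.sqrt Real.pi]] := by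
  rw [fermiExp, Real.div_sqrt]

theorem expU_neg_neg (c d : Fin 2 → ℝ) : expU (-c) (-d) = expU c d := by
  simp only [expU, Pi.neg_apply]; ring

theorem expV_neg_neg (c d : Fin 2 → ℝ) : expV (-c) (-d) = expV c d := by
  simp only [expV, Pi.neg_apply]; ring

theorem vertexKernel_neg_neg (c d : Fin 2 → ℝ) (ε : ℝ) (z : Spacetime) :
    vertexKernel (-c) (-d) ε z = vertexKernel c d ε z := by
  simp only [vertexKernel_eq, expU_neg_neg, expV_neg_neg, Pi.neg_apply, Complex.ofReal_neg,
    neg_mul_neg]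

theorem exp_fermiExp_sqrt_pi (a b : Fin 2) :
    expU (fermiExp (Real.sqrt Real.pi) a) (fermiExp (Real.sqrt Real.pi) b) =
        !![1, 0; 0, 0] a b ∧
      expV (fermiExp (Real.sqrt Real.pi) a) (fermiExp (Real.sqrt Real.pi) b) =
        !![0, 0; 0, 1] a b := by
  have hs : Real.sqrt Real.pi * Real.sqrt Real.pi = Real.pi := Real.mul_self_sqrt Real.pi_pos.le
  have hpi := Real.pi_ne_zero
  rw [fermiExp_sqrt_pi]
  set s := Real.sqrt Real.pi
  have h1 : (s + s) * (s + s) / (4 * Real.pi) = 1 := by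
    rw [div_eq_one_iff_eq (by positivity)]
    linear_combination 4 * hs
  have h2 : (-s - s) * (-s - s) / (4 * Real.pi) = 1 := by rw [← h1]; ring
  fin_cases a <;> fin_cases b <;> simp [expU, expV, h1, h2]

theorem fermiExp_sqrt_pi_wedge (a b : Fin 2) :
    (fermiExp (Real.sqrt Real.pi) a 0 : ℂ) * fermiExp (Real.sqrt Real.pi) b 1 -
      fermiExp (Real.sqrt Real.pi) a 1 * fermiExp (Real.sqrt Real.pi) b 0 =
      !![0, 2 * Real.pi; -(2 * Real.pi), 0] a b := by
  have hs : (Real.sqrt Real.pi : ℂ) * Real.sqrt Real.pi = Real.pi := by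
    rw [← Complex.ofReal_mul, Real.mul_self_sqrt Real.pi_pos.le]
  rw [fermiExp_sqrt_pi]
  fin_cases a <;> fin_cases b <;> simp [hs] <;> ring

/-- At `α = √π` the kernel of `ψₐ ⋆ ψₐ` is the first power of one lightcone coordinate. -/
theorem vertexKernel_fermi_self (a : Fin 2) {ε : ℝ} (hε : 0 < ε) (z : Spacetime) :
    vertexKernel (fermiExp (Real.sqrt Real.pi) a) (fermiExp (Real.sqrt Real.pi) a) ε z =
      Complex.I * lc a z + ε := by
  have hw := fermiExp_sqrt_pi_wedge a a
  obtain ⟨h1, h2⟩ := exp_fermiExp_sqrt_pi a a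
  rw [vertexKernel_eq, hw, h1, h2]
  have hne : ∀ s : ℝ, Complex.I * (s : ℂ) + ε ≠ 0 := fun s =>
    Complex.slitPlane_ne_zero (ofReal_mul_I_add_mem_slitPlane s hε)
  fin_cases a <;> simp [lc, Complex.exp_log (hne _)]

/-- At `α = √π` the kernel of `ψₐ* ⋆ ψₐ` is a simple pole in one lightcone coordinate. -/
theorem vertexKernel_fermiAdj_self (a : Fin 2) {ε : ℝ} (hε : 0 < ε) (z : Spacetime) :
    vertexKernel (-fermiExp (Real.sqrt Real.pi) a) (fermiExp (Real.sqrt Real.pi) a) ε z =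
      (Complex.I * lc a z + ε)⁻¹ := by
  rw [← vertexKernel_fermi_self a hε, vertexKernel_eq, vertexKernel_eq, ← Complex.exp_neg]
  congr 1
  simp only [expU, expV, Pi.neg_apply]
  push_cast
  ring

theorem vertexKernel_fermiAdj_self' (a : Fin 2) {ε : ℝ} (hε : 0 < ε) (z : Spacetime) :
    vertexKernel (fermiExp (Real.sqrt Real.pi) a) (-fermiExp (Real.sqrt Real.pi) a) ε z =
      (Complex.I * lc a z + ε)⁻¹ := by
  rw [← vertexKernel_neg_neg, neg_neg, vertexKernel_fermiAdj_self a hε]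

/-- At `α = √π` the kernels between fields of opposite chirality are constant. -/
theorem vertexKernel_fermi_mixed {a b : Fin 2} (hab : a ≠ b) (ε : ℝ) (z : Spacetime) :
    vertexKernel (fermiExp (Real.sqrt Real.pi) a) (fermiExp (Real.sqrt Real.pi) b) ε z =
        ![Complex.I, -Complex.I] a ∧
      vertexKernel (-fermiExp (Real.sqrt Real.pi) a) (fermiExp (Real.sqrt Real.pi) b) ε z =
        ![-Complex.I, Complex.I] a := by
  have hw := fermiExp_sqrt_pi_wedge a b
  obtain ⟨h1, h2⟩ := exp_fermiExp_sqrt_pi a b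
  have e1 : Complex.I / 4 * (2 * Real.pi) = Complex.I / 2 * Real.pi := by ring
  have hk : vertexKernel (fermiExp (Real.sqrt Real.pi) a) (fermiExp (Real.sqrt Real.pi) b) ε z =
      ![Complex.I, -Complex.I] a := by
    rw [vertexKernel_eq, hw, h1, h2]
    fin_cases a <;> fin_cases b <;> simp at hab <;>
      simp [e1, exp_I_half_pi, exp_neg_I_half_pi]
  refine ⟨hk, ?_⟩
  have hinv : vertexKernel (-fermiExp (Real.sqrt Real.pi) a) (fermiExp (Real.sqrt Real.pi) b) ε z =
      (vertexKernel (fermiExp (Real.sqrt Real.pi) a) (fermiExp (Real.sqrt Real.pi) b) ε z)⁻¹ := by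
    rw [vertexKernel_eq, vertexKernel_eq, ← Complex.exp_neg]
    congr 1
    simp only [expU, expV, Pi.neg_apply]
    push_cast
    ring
  rw [hinv, hk]
  fin_cases a <;> simp

theorem lc_sub_comm (a : Fin 2) (x y : Spacetime) : lc a (y - x) = -lc a (x - y) := by
  rw [← neg_sub]
  fin_cases a
  · exact lcU_neg _
  · exact lcV_neg _

theorem lc_sub (a : Fin 2) (x y : Spacetime) : lc a (x - y) = lc a x - lc a y := by
  fin_cases a <;> simp [lc, lcU, lcV] <;> ring

theorem isAnticommutator_smeared_fermi {f g : Spacetime → ℂ} (hf : IsTest f) (hg : IsTest g)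
    (a b : Fin 2) :
    IsAnticommutator (smearedVertex volume f (fermiExp (Real.sqrt Real.pi) a))
      (smearedVertex volume g (fermiExp (Real.sqrt Real.pi) b)) 0 := by
  by_cases hab : a = b
  · subst hab
    have hlc := continuous_lc a
    refine isAnticommutator_smeared_of_continuousAt hf hg _ _
      (w := fun ε z => Complex.I * lc a z + ε) (w' := fun ε z => Complex.I * lc a z + ε)
      (fun _ _ _ _ _ _ => Continuous.continuousAt (by fun_prop))
      (fun _ _ _ _ _ _ => Continuous.continuousAt (by fun_prop))
      (fun ε hε z => vertexKernel_fermi_self a hε z)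
      (fun ε hε z => vertexKernel_fermi_self a hε z) (fun x _ y _ => ?_)
    rw [lc_sub_comm a x y]
    push_cast
    ring
  · refine isAnticommutator_smeared_of_continuousAt hf hg _ _
      (w := fun _ _ => ![Complex.I, -Complex.I] a) (w' := fun _ _ => ![Complex.I, -Complex.I] b)
      (fun _ _ _ _ _ _ => continuousAt_const) (fun _ _ _ _ _ _ => continuousAt_const)
      (fun ε _ z => (vertexKernel_fermi_mixed hab ε z).1)
      (fun ε _ z => (vertexKernel_fermi_mixed (Ne.symm hab) ε z).1) (fun x _ y _ => ?_)
    fin_cases a <;> fin_cases b <;> simp at hab <;> simp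

theorem isAnticommutator_smeared_fermiAdj_fermiAdj {f g : Spacetime → ℂ} (hf : IsTest f)
    (hg : IsTest g) (a b : Fin 2) :
    IsAnticommutator (smearedVertex volume f (-fermiExp (Real.sqrt Real.pi) a))
      (smearedVertex volume g (-fermiExp (Real.sqrt Real.pi) b)) 0 := by
  by_cases hab : a = b
  · subst hab
    have hlc := continuous_lc a
    refine isAnticommutator_smeared_of_continuousAt hf hg _ _
      (w := fun ε z => Complex.I * lc a z + ε) (w' := fun ε z => Complex.I * lc a z + ε)
      (fun _ _ _ _ _ _ => Continuous.continuousAt (by fun_prop))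
      (fun _ _ _ _ _ _ => Continuous.continuousAt (by fun_prop))
      (fun ε hε z => by rw [vertexKernel_neg_neg, vertexKernel_fermi_self a hε z])
      (fun ε hε z => by rw [vertexKernel_neg_neg, vertexKernel_fermi_self a hε z])
      (fun x _ y _ => ?_)
    rw [lc_sub_comm a x y]
    push_cast
    ring
  · refine isAnticommutator_smeared_of_continuousAt hf hg _ _
      (w := fun _ _ => ![Complex.I, -Complex.I] a) (w' := fun _ _ => ![Complex.I, -Complex.I] b)
      (fun _ _ _ _ _ _ => continuousAt_const) (fun _ _ _ _ _ _ => continuousAt_const)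
      (fun ε _ z => by rw [vertexKernel_neg_neg, (vertexKernel_fermi_mixed hab ε z).1])
      (fun ε _ z => by rw [vertexKernel_neg_neg, (vertexKernel_fermi_mixed (Ne.symm hab) ε z).1])
      (fun x _ y _ => ?_)
    fin_cases a <;> fin_cases b <;> simp at hab <;> simp

theorem isAnticommutator_smeared_fermiAdj_fermi_of_ne {f g : Spacetime → ℂ} (hf : IsTest f)
    (hg : IsTest g) {a b : Fin 2} (hab : a ≠ b) :
    IsAnticommutator (smearedVertex volume f (-fermiExp (Real.sqrt Real.pi) a))
      (smearedVertex volume g (fermiExp (Real.sqrt Real.pi) b)) 0 := by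
  refine isAnticommutator_smeared_of_continuousAt hf hg _ _
    (w := fun _ _ => ![-Complex.I, Complex.I] a) (w' := fun _ _ => ![-Complex.I, Complex.I] b)
    (fun _ _ _ _ _ _ => continuousAt_const) (fun _ _ _ _ _ _ => continuousAt_const)
    (fun ε _ z => (vertexKernel_fermi_mixed hab ε z).2)
    (fun ε _ z => by
      rw [← vertexKernel_neg_neg, neg_neg, (vertexKernel_fermi_mixed (Ne.symm hab) ε z).2])
    (fun x _ y _ => ?_)
  fin_cases a <;> fin_cases b <;> simp at hab <;> simp

theorem contDiff_vertex (c : Fin 2 → ℝ) (φ : Config) : ContDiff ℝ ∞ fun x => vertex c x φ := by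
  unfold vertex
  refine ContDiff.cexp (contDiff_const.mul (ContDiff.sum fun i _ => contDiff_const.mul ?_))
  exact Complex.ofRealCLM.contDiff.comp (contDiff_config φ i)

theorem IsTest.mul_vertex {f : Spacetime → ℂ} (hf : IsTest f) (c : Fin 2 → ℝ) (φ : Config) :
    IsTest fun x => f x * vertex c x φ :=
  ⟨hf.1.mul (contDiff_vertex c φ), hf.2.mul_right⟩

/-- A simple pole in a lightcone coordinate, integrated by parts into a logarithmic potential. -/
theorem integral_mul_pole {G : Spacetime → ℂ} (hG : IsTest G) (a : Fin 2) {σ ε : ℝ}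
    (hσ : σ * σ = 1) (hε : 0 < ε) (r : ℝ) :
    ∫ y, G y * (Complex.I * (σ * (r - lc a y) : ℝ) + ε)⁻¹ =
      -(Complex.I * σ) * logConv σ ε (deriv (fiberInt a G)) r := by
  have hinv : Continuous fun s : ℝ => (Complex.I * ((σ * (r - s) : ℝ) : ℂ) + ε)⁻¹ :=
    Continuous.inv₀ (by fun_prop) fun s =>
      Complex.slitPlane_ne_zero (ofReal_mul_I_add_mem_slitPlane _ hε)
  rw [integral_mul_comp_lc hG.1.continuous hG.2 a hinv]
  exact integral_mul_inv_eq_logConv hσ hε (contDiff_fiberInt hG.1 hG.2 a)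
    (hasCompactSupport_fiberInt hG.2 a) r

theorem continuous_pole (a : Fin 2) {ε : ℝ} (hε : 0 < ε) :
    Continuous fun z : Spacetime => (Complex.I * (lc a z : ℂ) + ε)⁻¹ := by
  have := continuous_lc a
  exact Continuous.inv₀ (by fun_prop) fun z =>
    Complex.slitPlane_ne_zero (ofReal_mul_I_add_mem_slitPlane _ hε)

theorem integral_bilocal_pole {f g : Spacetime → ℂ} (hf : IsTest f) (hg : IsTest g) (a : Fin 2)
    (c d : Fin 2 → ℝ) (φ : Config) {ε : ℝ} (hε : 0 < ε) :
    ∫ p, bilocal f g c d φ (fun z => (Complex.I * lc a z + ε)⁻¹) p ∂volume.prod volume =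
      -Complex.I * ∫ x, f x * vertex c x φ *
        logConv 1 ε (deriv (fiberInt a fun y => g y * vertex d y φ)) (lc a x) := by
  obtain ⟨R, hR⟩ := hf.isSource
  obtain ⟨R', hR'⟩ := hg.isSource
  rw [integral_prod _ (hR.integrable_bilocal hR' c d φ (continuous_pole a hε)),
    ← integral_const_mul]
  congr 1; ext x
  have := integral_mul_pole (hg.mul_vertex d φ) a (σ := 1) (by norm_num) hε (lc a x)
  rw [Complex.ofReal_one, mul_one] at this
  rw [mul_left_comm, ← this, ← integral_const_mul]
  congr 1; ext y
  rw [bilocal, lc_sub, one_mul]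
  ring

theorem integral_bilocal_pole_swap {f g : Spacetime → ℂ} (hf : IsTest f) (hg : IsTest g) (a : Fin 2)
    (c d : Fin 2 → ℝ) (φ : Config) {ε : ℝ} (hε : 0 < ε) :
    ∫ p, bilocal g f d c φ (fun z => (Complex.I * lc a z + ε)⁻¹) p ∂volume.prod volume =
      Complex.I * ∫ x, f x * vertex c x φ *
        logConv (-1) ε (deriv (fiberInt a fun y => g y * vertex d y φ)) (lc a x) := by
  obtain ⟨R, hR⟩ := hf.isSource
  obtain ⟨R', hR'⟩ := hg.isSource
  rw [integral_prod_symm _ (hR'.integrable_bilocal hR d c φ (continuous_pole a hε)),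
    ← integral_const_mul]
  congr 1; ext x
  have := integral_mul_pole (hg.mul_vertex d φ) a (σ := -1) (by norm_num) hε (lc a x)
  rw [Complex.ofReal_neg, Complex.ofReal_one, mul_neg_one, neg_neg] at this
  rw [mul_left_comm, ← this, ← integral_const_mul]
  congr 1; ext y
  rw [bilocal, lc_sub, neg_one_mul, neg_sub]
  ring

/-- At `α = √π` the symbol of `ψₐ` depends on a single lightcone coordinate on shell. -/
theorem vertex_lcPoint_sqrt_pi (a : Fin 2) {φ : Config} (hφ : OnShell φ) (s t : ℝ) :
    vertex (fermiExp (Real.sqrt Real.pi) a) (lcPoint a s t) φ =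
      vertex (fermiExp (Real.sqrt Real.pi) a) (lcPoint a s 0) φ := by
  set c := fermiExp (Real.sqrt Real.pi) a with hc
  have hph : ∀ x, phaseDeriv c φ x (lcDir (1 - a)) = 0 := by
    intro x
    rw [hc, fermiExp_sqrt_pi]
    fin_cases a
    · exact (phaseDeriv_dirV _ hφ x).trans (by simp)
    · exact (phaseDeriv_dirU _ hφ x).trans (by simp)
  have hd : ∀ t, HasDerivAt (fun t => vertex c (lcPoint a s t) φ) 0 t := by
    intro t
    have hl : HasDerivAt (fun t => lcPoint a s t) (lcDir (1 - a)) t := by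
      have e : ∀ t, lcPoint a s t = s • lcDir a + t • lcDir (1 - a) := fun t => by
        conv_lhs => rw [eq_lc a (lcPoint a s t), lc_lcPoint, lc_lcPoint']
      simp only [e]
      simpa using ((hasDerivAt_id t).smul_const (lcDir (1 - a))).const_add (s • lcDir a)
    have hV := (hasFDerivAt_vertex c φ (lcPoint a s t)).comp_hasDerivAt t hl
    refine hV.congr_deriv ?_
    have := hph (lcPoint a s t)
    simp only [phaseDeriv, Fin.sum_univ_two] at this
    simp [← mul_add, this]
  exact is_const_of_deriv_eq_zero (fun t => (hd t).differentiableAt) (fun t => (hd t).deriv) t 0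

theorem vertex_neg (c : Fin 2 → ℝ) (x : Spacetime) (φ : Config) :
    vertex (-c) x φ = (vertex c x φ)⁻¹ :=
  eq_inv_of_mul_eq_one_left (vertex_neg_mul_self c x φ)

theorem deltaLC_eq (a : Fin 2) (f g : Spacetime → ℂ) :
    deltaLC a f g = ∫ s, fiberInt a f s * fiberInt a g s := by
  fin_cases a <;> rfl

/-- The two orderings of `ψₐ*` and `ψₐ` have the boundary values `1/(±iw + 0)`, whose sum is
`2π δ(w)`; on shell the vertex operators at equal `w` cancel. -/
theorem isAnticommutator_smeared_fermiAdj_fermi_self {f g : Spacetime → ℂ} (hf : IsTest f)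
    (hg : IsTest g) (a : Fin 2) :
    IsAnticommutator (smearedVertex volume f (-fermiExp (Real.sqrt Real.pi) a))
      (smearedVertex volume g (fermiExp (Real.sqrt Real.pi) a))
      (fun _ => 2 * Real.pi * deltaLC a f g) := by
  set c := fermiExp (Real.sqrt Real.pi) a with hc
  obtain ⟨R, hR⟩ := hf.isSource
  obtain ⟨R', hR'⟩ := hg.isSource
  have hF := fun φ => hf.mul_vertex (-c) φ
  have hG := fun φ => hg.mul_vertex c φ
  have hβ := fun φ => contDiff_fiberInt (hG φ).1 (hG φ).2 a
  have hβs := fun φ => hasCompactSupport_fiberInt (hG φ).2 a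
  have hlim := fun (φ : Config) (σ : ℝ) (hσ : |σ| = 1) => tendsto_integral_logConv
    (μ := (volume : Measure Spacetime)) hσ ((hβ φ).continuous_deriv le_rfl) (hβs φ).deriv
    (hF φ).1.continuous (hF φ).2 (continuous_lc a)
  refine ⟨fun φ => -Complex.I * ∫ x, f x * vertex (-c) x φ *
      logConv 1 0 (deriv (fiberInt a fun y => g y * vertex c y φ)) (lc a x),
    fun φ => Complex.I * ∫ x, f x * vertex (-c) x φ *
      logConv (-1) 0 (deriv (fiberInt a fun y => g y * vertex c y φ)) (lc a x),
    isStarProduct_smearedVertex hR hR' _ _ fun φ => ?_,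
    isStarProduct_smearedVertex hR' hR _ _ fun φ => ?_, fun φ hφ => ?_⟩
  · refine ((hlim φ 1 (by simp)).const_mul (-Complex.I)).congr' ?_
    filter_upwards [self_mem_nhdsWithin] with ε hε
    rw [← integral_bilocal_pole hf hg a (-c) c φ hε]
    congr 1; ext p
    rw [bilocal, bilocal, hc, vertexKernel_fermiAdj_self a hε]
  · refine ((hlim φ (-1) (by simp)).const_mul Complex.I).congr' ?_
    filter_upwards [self_mem_nhdsWithin] with ε hε
    rw [← integral_bilocal_pole_swap hf hg a (-c) c φ hε]
    congr 1; ext p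
    rw [bilocal, bilocal, hc, vertexKernel_fermiAdj_self' a hε]
  · have hi : ∀ σ : ℝ, |σ| = 1 → Integrable fun x => f x * vertex (-c) x φ *
        logConv σ 0 (deriv (fiberInt a fun y => g y * vertex c y φ)) (lc a x) := fun σ hσ =>
      Continuous.integrable_of_hasCompactSupport ((hF φ).1.continuous.mul
        ((continuous_logConv hσ le_rfl zero_le_one ((hβ φ).continuous_deriv le_rfl)
          (hβs φ).deriv).comp (continuous_lc a))) (hF φ).2.mul_right
    beta_reduce
    rw [neg_mul, neg_add_eq_sub, ← mul_sub, ← integral_sub (hi (-1) (by simp)) (hi 1 (by simp))]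
    have e1 : ∀ x, f x * vertex (-c) x φ *
          logConv (-1) 0 (deriv (fiberInt a fun y => g y * vertex c y φ)) (lc a x) -
        f x * vertex (-c) x φ *
          logConv 1 0 (deriv (fiberInt a fun y => g y * vertex c y φ)) (lc a x) =
        -(2 * Real.pi * Complex.I) * (f x * vertex (-c) x φ *
          fiberInt a (fun y => g y * vertex c y φ) (lc a x)) := by
      intro x
      have := logConv_sub_logConv (hβ φ) (hβs φ) (lc a x)
      linear_combination (-(f x * vertex (-c) x φ)) * this
    simp only [e1]
    rw [integral_const_mul, integral_mul_comp_lc (hF φ).1.continuous (hF φ).2 a (hβ φ).continuous,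
      deltaLC_eq]
    have e2 : ∀ s, fiberInt a (fun x => f x * vertex (-c) x φ) s *
        fiberInt a (fun y => g y * vertex c y φ) s = fiberInt a f s * fiberInt a g s := by
      intro s
      have h0 := vertex_neg_mul_self c (lcPoint a s 0) φ
      simp only [fiberInt, vertex_neg, hc, vertex_lcPoint_sqrt_pi a hφ s, integral_mul_const]
      rw [← hc, ← vertex_neg]
      linear_combination (1 / 2 * (∫ t, f (lcPoint a s t)) * (1 / 2 * ∫ t, g (lcPoint a s t))) * h0
    simp only [e2]
    linear_combination (-(2 * Real.pi * ∫ s, fiberInt a f s * fiberInt a g s)) * Complex.I_mul_I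

theorem smear_fermi (α : ℝ) (a : Fin 2) (f : Spacetime → ℂ) :
    smear (fermi α a) f = smearedVertex volume (fun x => fermiCoeff a * f x) (fermiExp α a) := by
  rw [fermi_eq, smear_vertexField]

theorem smear_fermiAdj (α : ℝ) (a : Fin 2) (f : Spacetime → ℂ) :
    smear (fermiAdj α a) f =
      smearedVertex volume (fun x => (starRingEnd ℂ) (fermiCoeff a) * f x) (-fermiExp α a) := by
  rw [fermiAdj_eq, smear_vertexField]

theorem deltaLC_const_mul (a : Fin 2) (A B : ℂ) (f g : Spacetime → ℂ) :
    deltaLC a (fun x => A * f x) (fun x => B * g x) = A * B * deltaLC a f g := by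
  rw [deltaLC_eq, deltaLC_eq, ← integral_const_mul]
  congr 1; ext s
  simp only [fiberInt, integral_const_mul]
  ring

theorem isAnticommutator_fermi_fermi {f g : Spacetime → ℂ} (hf : IsTest f) (hg : IsTest g)
    (a b : Fin 2) :
    IsAnticommutator (smear (fermi (Real.sqrt Real.pi) a) f)
      (smear (fermi (Real.sqrt Real.pi) b) g) 0 := by
  rw [smear_fermi, smear_fermi]
  exact isAnticommutator_smeared_fermi (hf.const_mul _) (hg.const_mul _) a b

theorem isAnticommutator_fermiAdj_fermiAdj {f g : Spacetime → ℂ} (hf : IsTest f) (hg : IsTest g)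
    (a b : Fin 2) :
    IsAnticommutator (smear (fermiAdj (Real.sqrt Real.pi) a) f)
      (smear (fermiAdj (Real.sqrt Real.pi) b) g) 0 := by
  rw [smear_fermiAdj, smear_fermiAdj]
  exact isAnticommutator_smeared_fermiAdj_fermiAdj (hf.const_mul _) (hg.const_mul _) a b

theorem isAnticommutator_fermiAdj_fermi {f g : Spacetime → ℂ} (hf : IsTest f) (hg : IsTest g)
    (a b : Fin 2) :
    IsAnticommutator (smear (fermiAdj (Real.sqrt Real.pi) a) f)
      (smear (fermi (Real.sqrt Real.pi) b) g) (fun _ => if a = b then deltaLC a f g else 0) := by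
  rw [smear_fermi, smear_fermiAdj]
  by_cases hab : a = b
  · subst hab
    have := isAnticommutator_smeared_fermiAdj_fermi_self
      (hf.const_mul ((starRingEnd ℂ) (fermiCoeff a))) (hg.const_mul (fermiCoeff a)) a
    rw [deltaLC_const_mul, conj_fermiCoeff_mul] at this
    have h11 : !![1, Complex.I; -Complex.I, 1] a a = (1 : ℂ) := by fin_cases a <;> rfl
    rw [h11, mul_one, ← mul_assoc, mul_inv_cancel₀ (by simp [Real.pi_ne_zero]), one_mul] at this
    simpa using this
  · simp only [hab, if_false]
    exact isAnticommutator_smeared_fermiAdj_fermi_of_ne (hf.const_mul _) (hg.const_mul _) hab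

/-! ### The linear field and its star products with vertex operators -/

/-- The smeared field `Φ(a) = ∫ a(x) Φ(x) dx`. -/
def linearFunctional (a : Spacetime → ℂ) : Functional := fun φ => ∫ x, a x * (φ.1 0 x : ℂ)

/-- The functional derivatives of `linearFunctional a`, of which only the first two do not
vanish. -/
def linearDeriv (a : Spacetime → ℂ) :
    (n : ℕ) → Config → (Fin n → Fin 2) → ((Fin n → Spacetime) → ℂ) → ℂ
  | 0, φ, _, T => linearFunctional a φ * T Fin.elim0
  | 1, _, I, T => if I 0 = 0 then ∫ x, a x * T (fun _ => x) else 0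
  | _ + 2, _, _, _ => 0

theorem continuous_ofReal_config (φ : Config) (i : Fin 2) :
    Continuous fun x => (φ.1 i x : ℂ) :=
  Complex.continuous_ofReal.comp (continuous_config φ i)

theorem linearFunctional_add_smul {a : Spacetime → ℂ} {R : ℝ} (ha : IsSource volume a R)
    (φ h : Config) (t : ℝ) :
    linearFunctional a (φ + t • h) = linearFunctional a φ + t * linearFunctional a h := by
  unfold linearFunctional
  rw [← integral_const_mul, ← integral_add (ha.integrable_mul (continuous_ofReal_config φ 0))
    ((ha.integrable_mul (continuous_ofReal_config h 0)).const_mul _)]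
  congr 1; ext x
  have : (φ + t • h : Config).1 0 x = φ.1 0 x + t * h.1 0 x := rfl
  rw [this]
  push_cast
  ring

theorem sum_fin_one_arrow (h : (Fin 1 → Fin 2) → ℂ) :
    ∑ I : Fin 1 → Fin 2, h I = ∑ i, h (fun _ => i) :=
  ((Equiv.funUnique (Fin 1) (Fin 2)).symm.sum_comp h).symm

/-- The functional derivatives of the smeared field. -/
def linearDerivatives {a : Spacetime → ℂ} {R : ℝ} (ha : IsSource volume a R) :
    FunctionalDerivatives (linearFunctional a) where
  D := linearDeriv a
  map_add n φ I T T' hT hT' := by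
    match n with
    | 0 => simp only [linearDeriv]; ring
    | 1 =>
      simp only [linearDeriv]
      split_ifs
      · rw [← integral_add (ha.integrable_mul (continuous_diag hT.continuous))
          (ha.integrable_mul (continuous_diag hT'.continuous))]
        congr 1; ext x; ring
      · simp
    | _ + 2 => simp [linearDeriv]
  map_smul n φ I c T hT := by
    match n with
    | 0 => simp only [linearDeriv]; ring
    | 1 =>
      simp only [linearDeriv]
      split_ifs
      · rw [← integral_const_mul]
        congr 1; ext x; ring
      · simp
    | _ + 2 => simp [linearDeriv]
  bound n φ I := by
    match n with
    | 0 =>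
      refine ⟨0, 0, ‖linearFunctional a φ‖, fun T hT B hB => ?_⟩
      have := hB 0 le_rfl Fin.elim0 (by rw [Subsingleton.elim (Fin.elim0 : Fin 0 → Spacetime) 0]; simp)
      rw [norm_iteratedFDeriv_zero] at this
      simp only [linearDeriv, norm_mul]
      gcongr
    | 1 =>
      refine ⟨0, R, ∫ x, ‖a x‖, fun T hT B hB => ?_⟩
      have hB' : ∀ x : Spacetime, ‖x‖ ≤ R → ‖T fun _ => x‖ ≤ B := by
        intro x hx
        have h0 := hB 0 le_rfl (fun _ => x)
          ((pi_norm_le_iff_of_nonneg ((norm_nonneg x).trans hx)).mpr fun _ => hx)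
        rwa [norm_iteratedFDeriv_zero] at h0
      have key : ‖∫ x, a x * T fun _ => x‖ ≤ (∫ x, ‖a x‖) * B := by
        rw [← integral_mul_const]
        exact norm_integral_le_of_norm_le (ha.integrable.norm.mul_const _)
          (ha.exists_norm_mul_le hB')
      simp only [linearDeriv]
      split_ifs
      · exact key
      · rw [norm_zero]
        exact (norm_nonneg _).trans key
    | _ + 2 => exact ⟨0, 0, 0, fun T hT B hB => by simp [linearDeriv]⟩
  zeroth φ I T := rfl
  succ n φ I T hT h := by
    match n with
    | 0 =>
      simp only [linearDeriv, linearFunctional_add_smul ha, Fin.sum_univ_two, Fin.cons_zero]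
      have h1 : HasDerivAt (fun t : ℝ => (linearFunctional a φ + t * linearFunctional a h) *
          T Fin.elim0) (1 * linearFunctional a h * T Fin.elim0) 0 :=
        ((((hasDerivAt_id (0 : ℝ)).ofReal_comp).mul_const _).const_add _).mul_const _
      refine h1.congr_deriv ?_
      simp only [if_true, one_ne_zero, if_false, add_zero, one_mul, linearFunctional]
      rw [← integral_mul_const]
      congr 1; ext x
      rw [Subsingleton.elim (Fin.tail fun _ : Fin 1 => x) Fin.elim0]
      ring
    | 1 =>
      simp only [linearDeriv, Finset.sum_const_zero]
      exact hasDerivAt_const _ _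
    | _ + 2 =>
      simp only [linearDeriv, Finset.sum_const_zero]
      exact hasDerivAt_const _ _

theorem vertexDeriv_dirac (y : Spacetime) (A : ℂ) (d : Fin 2 → ℝ) (n : ℕ) (φ : Config)
    (I : Fin n → Fin 2) (T : (Fin n → Spacetime) → ℂ) :
    vertexDeriv (Measure.dirac y) (fun _ => A) d n φ I T =
      A * (vertex d y φ * ((∏ k, Complex.I * (d (I k) : ℂ)) * T fun _ => y)) := by
  simp [vertexDeriv]

/-- The star product of the smeared field with a vertex operator has a single contraction. -/
theorem isStarProduct_linear_vertex {a : Spacetime → ℂ} {R : ℝ} (ha : IsSource volume a R) (A : ℂ)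
    (d : Fin 2 → ℝ) (y : Spacetime) {ℓ : ℂ}
    (hℓ : Tendsto (fun ε => ∫ x, a x * ∑ j, Complex.I * d j * twoPointReg ε 0 j (x - y))
      (𝓝[>] 0) (𝓝 ℓ)) :
    IsStarProduct (linearFunctional a) (fun φ => A * vertex d y φ)
      (fun φ => A * vertex d y φ * (linearFunctional a φ + ℓ)) := by
  rw [← smearedVertex_dirac]
  refine ⟨linearDerivatives ha, vertexDerivatives (isSource_dirac y A) d, fun φ =>
    ⟨fun ε => A * vertex d y φ * (linearFunctional a φ +
      ∫ x, a x * ∑ j, Complex.I * d j * twoPointReg ε 0 j (x - y)), fun ε hε => ?_,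
      (hℓ.const_add _).const_mul _⟩⟩
  have h2 : ∀ n ∉ Finset.range 2, (n.factorial : ℂ)⁻¹ * ∑ I : Fin n → Fin 2, ∑ J : Fin n → Fin 2,
      linearDeriv a n φ I (fun x => vertexDeriv (Measure.dirac y) (fun _ => A) d n φ J
        (fun y => ∏ k, twoPointReg ε (I k) (J k) (x k - y k))) = 0 := by
    intro n hn
    obtain ⟨m, rfl⟩ : ∃ m, n = m + 2 :=
      Nat.exists_eq_add_of_le' (not_lt.mp fun h => hn (Finset.mem_range.mpr h))
    simp [linearDeriv]
  have hs := hasSum_sum_of_ne_finset_zero (L := SummationFilter.unconditional ℕ) h2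
  refine Eq.subst (motive := HasSum _) ?_ hs
  have hi : ∀ j, Integrable fun x => a x * (A * (vertex d y φ *
      (Complex.I * d j * twoPointReg ε 0 j (x - y)))) := fun j => by
    have := continuous_twoPointReg hε 0 j
    exact ha.integrable_mul (by fun_prop)
  rw [Finset.sum_range_succ, Finset.sum_range_one]
  simp only [linearDeriv, vertexDeriv_dirac, sum_fin_one_arrow, Fin.sum_univ_two, if_true,
    one_ne_zero, if_false, add_zero, Finset.univ_unique, Finset.sum_singleton, Finset.prod_singleton,
    Finset.univ_eq_empty, Finset.prod_empty, Nat.factorial, Nat.cast_one, inv_one, one_mul, mul_one]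
  rw [← integral_add (hi 0) (hi 1), mul_add, ← integral_const_mul]
  congr 1
  · ring
  · congr 1; ext x; ring

theorem isStarProduct_vertex_linear {a : Spacetime → ℂ} {R : ℝ} (ha : IsSource volume a R) (A : ℂ)
    (d : Fin 2 → ℝ) (y : Spacetime) {ℓ : ℂ}
    (hℓ : Tendsto (fun ε => ∫ x, a x * ∑ i, Complex.I * d i * twoPointReg ε i 0 (y - x))
      (𝓝[>] 0) (𝓝 ℓ)) :
    IsStarProduct (fun φ => A * vertex d y φ) (linearFunctional a)
      (fun φ => A * vertex d y φ * (linearFunctional a φ + ℓ)) := by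
  rw [← smearedVertex_dirac]
  refine ⟨vertexDerivatives (isSource_dirac y A) d, linearDerivatives ha, fun φ =>
    ⟨fun ε => A * vertex d y φ * (linearFunctional a φ +
      ∫ x, a x * ∑ i, Complex.I * d i * twoPointReg ε i 0 (y - x)), fun ε hε => ?_,
      (hℓ.const_add _).const_mul _⟩⟩
  have h2 : ∀ n ∉ Finset.range 2, (n.factorial : ℂ)⁻¹ * ∑ I : Fin n → Fin 2, ∑ J : Fin n → Fin 2,
      vertexDeriv (Measure.dirac y) (fun _ => A) d n φ I (fun x => linearDeriv a n φ J
        (fun y => ∏ k, twoPointReg ε (I k) (J k) (x k - y k))) = 0 := by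
    intro n hn
    obtain ⟨m, rfl⟩ : ∃ m, n = m + 2 :=
      Nat.exists_eq_add_of_le' (not_lt.mp fun h => hn (Finset.mem_range.mpr h))
    simp [linearDeriv, vertexDeriv]
  have hs := hasSum_sum_of_ne_finset_zero (L := SummationFilter.unconditional ℕ) h2
  refine Eq.subst (motive := HasSum _) ?_ hs
  have hi : ∀ i, Integrable fun x => a x * (Complex.I * d i * twoPointReg ε i 0 (y - x)) :=
    fun i => by
      have := continuous_twoPointReg hε i 0
      exact ha.integrable_mul (by fun_prop)
  rw [Finset.sum_range_succ, Finset.sum_range_one]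
  simp only [linearDeriv, vertexDeriv_dirac, sum_fin_one_arrow, Fin.sum_univ_two, if_true,
    one_ne_zero, if_false, Finset.univ_unique, Finset.sum_singleton, Finset.prod_singleton,
    Finset.univ_eq_empty, Finset.prod_empty, Nat.factorial, Nat.cast_one, inv_one, one_mul, mul_one]
  simp only [mul_add]
  have hm : ∀ i, ∫ x, a x * (Complex.I * d i * twoPointReg ε i 0 (y - x)) =
      Complex.I * d i * ∫ x, a x * twoPointReg ε i 0 (y - x) := fun i => by
    rw [← integral_const_mul]
    congr 1; ext x; ring
  rw [integral_add (hi 0) (hi 1), hm, hm]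
  ring

/-! ### The charge -/

theorem sum_twoPointReg_zero_left (d : Fin 2 → ℝ) (ε : ℝ) (z : Spacetime) :
    ∑ j, Complex.I * d j * twoPointReg ε 0 j z =
      -(Complex.I * (d 0 + d 1) / (4 * Real.pi)) * Complex.log (Complex.I * lcU z + ε) +
      -(Complex.I * (d 0 - d 1) / (4 * Real.pi)) * Complex.log (Complex.I * lcV z + ε) +
      d 1 / 4 := by
  have hpi : (Real.pi : ℂ) ≠ 0 := by exact_mod_cast Real.pi_ne_zero
  simp only [Fin.sum_univ_two, twoPointReg, Matrix.of_apply, Matrix.cons_val',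
    Matrix.cons_val_zero, Matrix.cons_val_one, Matrix.cons_val_fin_one]
  linear_combination (-(d 1 : ℂ) / 4) * Complex.I_mul_I

theorem sum_twoPointReg_zero_right (d : Fin 2 → ℝ) (ε : ℝ) (z : Spacetime) :
    ∑ i, Complex.I * d i * twoPointReg ε i 0 z =
      -(Complex.I * (d 0 + d 1) / (4 * Real.pi)) * Complex.log (Complex.I * lcU z + ε) +
      -(Complex.I * (d 0 - d 1) / (4 * Real.pi)) * Complex.log (Complex.I * lcV z + ε) -
      d 1 / 4 := by
  simp only [Fin.sum_univ_two, twoPointReg, Matrix.of_apply, Matrix.cons_val',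
    Matrix.cons_val_zero, Matrix.cons_val_one, Matrix.cons_val_fin_one]
  linear_combination ((d 1 : ℂ) / 4) * Complex.I_mul_I

theorem hasCompactSupport_mul_prod {τ b : ℝ → ℂ} (hτs : HasCompactSupport τ)
    (hbs : HasCompactSupport b) : HasCompactSupport fun x : Spacetime => τ x.1 * b x.2 := by
  refine HasCompactSupport.of_support_subset_isCompact (hτs.isCompact.prod hbs.isCompact)
    fun x hx => ⟨subset_tsupport τ (left_ne_zero_of_mul hx), subset_tsupport b
      (right_ne_zero_of_mul hx)⟩

section Charge

variable {τ b : ℝ → ℂ}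

theorem integrable_mul_prod_mul (hτ : Continuous τ) (hτs : HasCompactSupport τ)
    (hb : Continuous b) (hbs : HasCompactSupport b) {w : Spacetime → ℂ} (hw : Continuous w) :
    Integrable fun x : Spacetime => τ x.1 * b x.2 * w x := by
  refine Continuous.integrable_of_hasCompactSupport ?_
    (hasCompactSupport_mul_prod hτs hbs).mul_right
  fun_prop

theorem continuous_log_prod (σ : ℝ) {ε : ℝ} (hε : 0 < ε) {ρ : ℝ → ℝ} (hρ : Continuous ρ) :
    Continuous fun x : Spacetime => Complex.log (Complex.I * (σ * (ρ x.1 - x.2) : ℝ) + ε) :=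
  (continuous_log_line σ hε).comp ((hρ.comp continuous_fst).sub continuous_snd)

/-- Fubini for a logarithm of a lightcone coordinate: the integral over `s = x¹` is a logarithmic
potential. -/
theorem integral_prod_log (hτ : Continuous τ) (hτs : HasCompactSupport τ)
    (hb : Continuous b) (hbs : HasCompactSupport b) (σ : ℝ) {ε : ℝ} (hε : 0 < ε) {ρ : ℝ → ℝ}
    (hρ : Continuous ρ) :
    ∫ x : Spacetime, τ x.1 * b x.2 * Complex.log (Complex.I * (σ * (ρ x.1 - x.2) : ℝ) + ε) =
      ∫ t, τ t * logConv σ ε b (ρ t) := by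
  have h := integral_prod (μ := (volume : Measure ℝ)) (ν := (volume : Measure ℝ)) _
    (integrable_mul_prod_mul hτ hτs hb hbs (continuous_log_prod σ hε hρ))
  refine Eq.trans h ?_
  congr 1; ext t
  rw [logConv, ← integral_const_mul]
  congr 1; ext s
  ring

theorem tendsto_integral_prod_log (hτ : Continuous τ) (hτs : HasCompactSupport τ)
    (hb : Continuous b) (hbs : HasCompactSupport b) {σ σ' : ℝ} (hσ : |σ| = 1) (hσ' : |σ'| = 1)
    {ρ ρ' : ℝ → ℝ} (hρ : Continuous ρ) (hρ' : Continuous ρ') (A B C : ℂ) :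
    Tendsto (fun ε : ℝ => ∫ x : Spacetime, τ x.1 * b x.2 *
        (A * Complex.log (Complex.I * (σ * (ρ x.1 - x.2) : ℝ) + ε) +
          B * Complex.log (Complex.I * (σ' * (ρ' x.1 - x.2) : ℝ) + ε) + C)) (𝓝[>] 0)
      (𝓝 (A * (∫ t, τ t * logConv σ 0 b (ρ t)) + B * (∫ t, τ t * logConv σ' 0 b (ρ' t)) +
        C * ((∫ t, τ t) * ∫ s, b s))) := by
  refine ((((tendsto_integral_logConv (μ := (volume : Measure ℝ)) hσ hb hbs hτ hτs hρ).const_mul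
    A).add ((tendsto_integral_logConv (μ := (volume : Measure ℝ)) hσ' hb hbs hτ hτs hρ').const_mul
    B)).add_const _).congr' ?_
  filter_upwards [self_mem_nhdsWithin] with ε hε
  have i1 := integrable_mul_prod_mul hτ hτs hb hbs (continuous_log_prod σ hε hρ)
  have i2 := integrable_mul_prod_mul hτ hτs hb hbs (continuous_log_prod σ' hε hρ')
  have i3 := integrable_mul_prod_mul hτ hτs hb hbs (continuous_const (y := (1 : ℂ)))
  simp only [mul_one] at i3
  have i12 : Integrable fun x : Spacetime =>
      A * (τ x.1 * b x.2 * Complex.log (Complex.I * (σ * (ρ x.1 - x.2) : ℝ) + ε)) +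
        B * (τ x.1 * b x.2 * Complex.log (Complex.I * (σ' * (ρ' x.1 - x.2) : ℝ) + ε)) :=
    (i1.const_mul A).add (i2.const_mul B)
  have hQ : ∫ x : Spacetime, τ x.1 * b x.2 = (∫ t, τ t) * ∫ s, b s := integral_prod_mul τ b
  rw [← integral_prod_log hτ hτs hb hbs σ hε hρ, ← integral_prod_log hτ hτs hb hbs σ' hε hρ', ← hQ,
    ← integral_const_mul, ← integral_const_mul, ← integral_const_mul,
    ← integral_add (i1.const_mul A) (i2.const_mul B),
    ← integral_add i12 (i3.const_mul C)]
  congr 1; ext x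
  ring

end Charge

/-- The commutator of a spatially smeared derivative of the field with a vertex operator: the
logarithms of both lightcone coordinates jump across the lightcone of `y`, and the jumps are
integrated against `χ'`, giving the values of `χ` at the two points of the lightcone. -/
theorem isCommutator_linear_vertex {τ χ : ℝ → ℂ} (hτ : Continuous τ) (hτs : HasCompactSupport τ)
    (hχ : ContDiff ℝ 1 χ) (hχs : HasCompactSupport χ) (A : ℂ) (d : Fin 2 → ℝ) (y : Spacetime)
    (h : ∀ t, τ t ≠ 0 → χ (y.2 - (t - y.1)) = 1 ∧ χ (y.2 + (t - y.1)) = 1) :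
    IsCommutator (linearFunctional fun x => τ x.1 * deriv χ x.2) (fun φ => A * vertex d y φ)
      (fun φ => -(d 1 * ∫ t, τ t) * (A * vertex d y φ)) := by
  have hb : Continuous (deriv χ) := hχ.continuous_deriv le_rfl
  have hbs : HasCompactSupport (deriv χ) := hχs.deriv
  have hρ : Continuous fun t => y.2 - (t - y.1) := by fun_prop
  have hρ' : Continuous fun t => y.2 + (t - y.1) := by fun_prop
  have h1 : |(1 : ℝ)| = 1 := abs_one
  have h1' : |(-1 : ℝ)| = 1 := by simp
  obtain ⟨R, hR⟩ : ∃ R, IsSource volume (fun x : Spacetime => τ x.1 * deriv χ x.2) R := by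
    obtain ⟨R, hR⟩ := (hasCompactSupport_mul_prod hτs hbs).isCompact.isBounded.subset_closedBall
      (0 : Spacetime)
    refine ⟨R, ?_, ae_of_all _ fun x hx => ?_⟩
    · simpa using integrable_mul_prod_mul hτ hτs hb hbs (continuous_const (y := (1 : ℂ)))
    · by_contra hne
      have := hR (subset_tsupport _ hne)
      rw [mem_closedBall_zero_iff] at this
      linarith
  set a₁ : ℂ := -(Complex.I * (d 0 + d 1) / (4 * Real.pi)) with ha₁
  set a₂ : ℂ := -(Complex.I * (d 0 - d 1) / (4 * Real.pi)) with ha₂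
  -- exchanging the factors of the product reverses the signs of both lightcone coordinates
  have t1 := tendsto_integral_prod_log hτ hτs hb hbs h1' h1 hρ hρ' a₁ a₂ (d 1 / 4)
  have t2 := tendsto_integral_prod_log hτ hτs hb hbs h1 h1' hρ hρ' a₁ a₂ (-(d 1 / 4))
  refine ⟨_, _, isStarProduct_linear_vertex hR A d y (t1.congr fun ε => ?_),
    isStarProduct_vertex_linear hR A d y (t2.congr fun ε => ?_), fun φ _ => ?_⟩
  · congr 1; ext x
    rw [sum_twoPointReg_zero_left, ← ha₁, ← ha₂]
    have e1 : lcU (x - y) = -1 * (y.2 - (x.1 - y.1) - x.2) := by simp [lcU]; ring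
    have e2 : lcV (x - y) = 1 * (y.2 + (x.1 - y.1) - x.2) := by simp [lcV]; ring
    rw [e1, e2]
  · congr 1; ext x
    rw [sum_twoPointReg_zero_right, ← ha₁, ← ha₂, sub_eq_add_neg _ ((d 1 : ℂ) / 4)]
    have e1 : lcU (y - x) = 1 * (y.2 - (x.1 - y.1) - x.2) := by simp [lcU]; ring
    have e2 : lcV (y - x) = -1 * (y.2 + (x.1 - y.1) - x.2) := by simp [lcV]; ring
    rw [e1, e2]
  · have hint : ∀ {σ : ℝ}, |σ| = 1 → ∀ {ρ : ℝ → ℝ}, Continuous ρ →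
        Integrable fun t => τ t * logConv σ 0 (deriv χ) (ρ t) := fun hσ _ hρ =>
      Continuous.integrable_of_hasCompactSupport
        (hτ.mul ((continuous_logConv hσ le_rfl zero_le_one hb hbs).comp hρ)) hτs.mul_right
    have jump : ∀ {ρ : ℝ → ℝ}, Continuous ρ → (∀ t, τ t ≠ 0 → χ (ρ t) = 1) →
        (∫ t, τ t * logConv 1 0 (deriv χ) (ρ t)) - ∫ t, τ t * logConv (-1) 0 (deriv χ) (ρ t) =
          2 * Real.pi * Complex.I * ∫ t, τ t := by
      intro ρ hρ hχ1
      rw [← integral_sub (hint h1 hρ) (hint h1' hρ), ← integral_const_mul]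
      congr 1; ext t
      rw [← mul_sub, logConv_sub_logConv hχ hχs]
      by_cases ht : τ t = 0
      · simp [ht]
      · rw [hχ1 t ht]; ring
    have j1 := jump hρ fun t ht => (h t ht).1
    have j2 := jump hρ' fun t ht => (h t ht).2
    -- the constant part of the commutator function multiplies `∫ χ' = 0`
    have hQ : ∫ s, deriv χ s = 0 := integral_eq_zero_of_hasDerivAt_of_integrable
      (fun s => (hχ.differentiable one_ne_zero s).hasDerivAt)
      (hb.integrable_of_hasCompactSupport hbs)
      (hχ.continuous.integrable_of_hasCompactSupport hχs)
    have hc : (a₂ - a₁) * (2 * Real.pi * Complex.I) = -d 1 := by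
      have hpi : (Real.pi : ℂ) ≠ 0 := by exact_mod_cast Real.pi_ne_zero
      rw [ha₁, ha₂]
      field_simp
      linear_combination (4 * d 1 : ℂ) * Complex.I_sq
    beta_reduce
    rw [hQ]
    linear_combination (A * vertex d y φ) * (-a₁ * j1 + a₂ * j2 + (∫ t, τ t) * hc)

/-- The normalization of the currents is `Z = 2α² / (α² + π)`. -/
theorem exists_current_eq_normalDensity {α : ℝ} (hα : 0 < α) :
    ∃ Z : ℝ, 0 < Z ∧ ∀ a x, current α a x = fun φ => Z * normalDensity α a x φ := by
  have hpi := Real.pi_pos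
  have hZ : (α : ℂ) / Real.pi =
      ((2 * α ^ 2 / (α ^ 2 + Real.pi) : ℝ) : ℂ) * (α / (2 * Real.pi) + 1 / (2 * α)) := by
    have : α / Real.pi = 2 * α ^ 2 / (α ^ 2 + Real.pi) * (α / (2 * Real.pi) + 1 / (2 * α)) := by
      field_simp
    exact_mod_cast this
  refine ⟨2 * α ^ 2 / (α ^ 2 + Real.pi), by positivity, fun a x => funext fun φ => ?_⟩
  fin_cases a
  · change -(α / Real.pi : ℂ) * dPhi 0 x φ = _ * (-(_ + _) * dPhi 0 x φ)
    rw [hZ]; ring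
  · change (α / Real.pi : ℂ) * dPhi 1 x φ = _ * ((_ + _) * dPhi 1 x φ)
    rw [hZ]; ring

theorem diracCurrent_current (α : ℝ) (x : Spacetime) (φ : Config) :
    diracCurrent (current α) 0 x φ = -(α / Real.pi) * (fderiv ℝ (φ.1 0) x (0, 1) : ℂ) := by
  have e1 : ((0, 1) : Spacetime) = dirU - dirV := by ext <;> norm_num [dirU, dirV]
  rw [e1, map_sub]
  simp [diracCurrent, current, gamma, gammaLow, Fin.sum_univ_two, dPhi]
  ring

/-- The smeared charge density is, after an integration by parts in `x¹`, a smeared field. -/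
theorem smear_diracCurrent_current (α : ℝ) {τ χ : ℝ → ℝ} (hτ : ContDiff ℝ ∞ τ)
    (hτs : HasCompactSupport τ) (hχ : ContDiff ℝ ∞ χ) (hχs : HasCompactSupport χ) :
    smear (diracCurrent (current α) 0) (fun x => (τ x.1 : ℂ) * (χ x.2 : ℂ)) =
      linearFunctional fun x => ((α / Real.pi : ℝ) * (τ x.1 : ℂ)) *
        deriv (fun s => (χ s : ℂ)) x.2 := by
  ext φ
  have hφ := contDiff_config φ 0
  have hg : ContDiff ℝ ∞ fun x : Spacetime => τ x.1 * χ x.2 :=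
    (hτ.comp contDiff_fst).mul (hχ.comp contDiff_snd)
  have hgs : HasCompactSupport fun x : Spacetime => τ x.1 * χ x.2 := by
    refine HasCompactSupport.of_support_subset_isCompact (hτs.isCompact.prod hχs.isCompact)
      fun x hx => ⟨subset_tsupport τ (left_ne_zero_of_mul hx), subset_tsupport χ
        (right_ne_zero_of_mul hx)⟩
  have hdg : ∀ x : Spacetime, fderiv ℝ (fun x : Spacetime => τ x.1 * χ x.2) x (0, 1) =
      τ x.1 * deriv χ x.2 := by
    intro x
    have h1 : HasFDerivAt (fun x : Spacetime => τ x.1) _ x :=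
      ((hτ.differentiable (by simp) x.1).hasFDerivAt).comp x hasFDerivAt_fst
    have h2 : HasFDerivAt (fun x : Spacetime => χ x.2) _ x :=
      ((hχ.differentiable (by simp) x.2).hasFDerivAt).comp x hasFDerivAt_snd
    have h3 : HasFDerivAt (fun x : Spacetime => τ x.1 * χ x.2) _ x := h1.mul h2
    rw [h3.fderiv]
    simp
  have hdφ : Continuous fun x => fderiv ℝ (φ.1 0) x (0, 1) :=
    (hφ.continuous_fderiv (by simp)).clm_apply continuous_const
  have hdgc : Continuous fun x => fderiv ℝ (fun x : Spacetime => τ x.1 * χ x.2) x (0, 1) :=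
    (hg.continuous_fderiv (by simp)).clm_apply continuous_const
  have ibp := integral_mul_fderiv_eq_neg_fderiv_mul_of_integrable (μ := (volume : Measure Spacetime))
    (f := fun x : Spacetime => τ x.1 * χ x.2) (g := φ.1 0) (v := (0, 1))
    ((hdgc.mul hφ.continuous).integrable_of_hasCompactSupport
      ((hgs.fderiv_apply (𝕜 := ℝ) (0, 1)).mul_right))
    ((hg.continuous.mul hdφ).integrable_of_hasCompactSupport hgs.mul_right)
    ((hg.continuous.mul hφ.continuous).integrable_of_hasCompactSupport hgs.mul_right)
    (fun x _ => hg.differentiable (by simp) x) (fun x _ => hφ.differentiable (by simp) x)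
  have hdχ : ∀ s, deriv (fun s => (χ s : ℂ)) s = ((deriv χ s : ℝ) : ℂ) := fun s =>
    (hχ.differentiable (by simp) s).hasDerivAt.ofReal_comp.deriv
  have e1 : smear (diracCurrent (current α) 0) (fun x => (τ x.1 : ℂ) * (χ x.2 : ℂ)) φ =
      ((-(α / Real.pi) * ∫ x : Spacetime, τ x.1 * χ x.2 * fderiv ℝ (φ.1 0) x (0, 1) : ℝ) : ℂ) := by
    rw [smear, Complex.ofReal_mul, ← integral_complex_ofReal, ← integral_const_mul]
    congr 1; ext x
    rw [diracCurrent_current]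
    push_cast
    ring
  rw [e1, ibp, linearFunctional]
  simp only [hdχ, hdg]
  rw [neg_mul_neg, Complex.ofReal_mul, ← integral_complex_ofReal, ← integral_const_mul]
  congr 1; ext x
  push_cast
  ring

theorem hasCharge_vertexField {α : ℝ} (hα : 0 < α) (A : ℂ) {d : Fin 2 → ℝ}
    (hd : d 1 = Real.pi / α) :
    HasCharge (diracCurrent (current α) 0) (vertexField A d) (-1) := by
  intro y τ χ hτ hτs hχ hχs hint hone
  rw [smear_diracCurrent_current α hτ hτs hχ hχs]
  have hτc : HasCompactSupport fun t => ((α / Real.pi : ℝ) : ℂ) * (τ t : ℂ) :=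
    (hτs.comp_left Complex.ofReal_zero).mul_left
  have key := isCommutator_linear_vertex (τ := fun t => ((α / Real.pi : ℝ) : ℂ) * (τ t : ℂ))
    (χ := fun s => (χ s : ℂ))
    (continuous_const.mul (Complex.continuous_ofReal.comp hτ.continuous)) hτc
    (Complex.ofRealCLM.contDiff.comp (hχ.of_le (by simp))) (hχs.comp_left Complex.ofReal_zero)
    A d y (fun t ht => ?_)
  · have hα' : (α : ℂ) ≠ 0 := by exact_mod_cast hα.ne'
    have hpi : (Real.pi : ℂ) ≠ 0 := by exact_mod_cast Real.pi_ne_zero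
    rw [integral_const_mul, integral_complex_ofReal, hint, hd] at key
    have e : -(((Real.pi / α : ℝ) : ℂ) * (((α / Real.pi : ℝ) : ℂ) * ((1 : ℝ) : ℂ))) = -1 := by
      push_cast
      field_simp
    rw [e] at key
    exact key
  · have ht' : t ∈ tsupport τ := subset_tsupport τ fun h0 => ht (by simp [h0])
    constructor
    · exact_mod_cast hone t ht' _ (by rw [sub_sub_cancel_left, abs_neg])
    · exact_mod_cast hone t ht' _ (by rw [add_sub_cancel_left])

theorem hasCharge_fermi {α : ℝ} (hα : 0 < α) (a : Fin 2) :
    HasCharge (diracCurrent (current α) 0) (fermi α a) (-1) := by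
  rw [fermi_eq]
  refine hasCharge_vertexField hα _ ?_
  fin_cases a <;> rfl

end Thirring

end

theorem mainTheorem7 :
    -- spacelike anticommutation of all components and their adjoints
    (∀ α : ℝ, 0 < α → ∀ a b : Fin 2,
      Thirring.AnticommuteSpacelike (Thirring.fermi α a) (Thirring.fermi α b) ∧
      Thirring.AnticommuteSpacelike (Thirring.fermiAdj α a) (Thirring.fermi α b) ∧
      Thirring.AnticommuteSpacelike (Thirring.fermiAdj α a) (Thirring.fermiAdj α b)) ∧
    -- free chiral Fermi fields for `α = √π`
    ((∀ f g : Thirring.Spacetime → ℂ, Thirring.IsTest f → Thirring.IsTest g → ∀ a b : Fin 2,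
        Thirring.IsAnticommutator
          (Thirring.smear (Thirring.fermi (Real.sqrt Real.pi) a) f)
          (Thirring.smear (Thirring.fermi (Real.sqrt Real.pi) b) g) 0 ∧
        Thirring.IsAnticommutator
          (Thirring.smear (Thirring.fermiAdj (Real.sqrt Real.pi) a) f)
          (Thirring.smear (Thirring.fermiAdj (Real.sqrt Real.pi) b) g) 0 ∧
        Thirring.IsAnticommutator
          (Thirring.smear (Thirring.fermiAdj (Real.sqrt Real.pi) a) f)
          (Thirring.smear (Thirring.fermi (Real.sqrt Real.pi) b) g)
          (fun _ => if a = b then Thirring.deltaLC a f g else 0)) ∧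
      ∀ φ : Thirring.Config, Thirring.OnShell φ → ∀ x : Thirring.Spacetime,
        HasLineDerivAt ℝ (fun y => Thirring.fermi (Real.sqrt Real.pi) 0 y φ) 0 x Thirring.dirV ∧
        HasLineDerivAt ℝ (fun y => Thirring.fermi (Real.sqrt Real.pi) 1 y φ) 0 x Thirring.dirU) ∧
    -- the equations of motion and the massless Thirring field equations for general `α`
    (∀ α : ℝ, 0 < α →
      (∀ φ : Thirring.Config, Thirring.OnShell φ → ∀ x : Thirring.Spacetime,
        HasLineDerivAt ℝ (fun y => Thirring.fermi α 0 y φ)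
          (Complex.I * (α - Real.pi / α) * Thirring.dPhi 1 x φ * Thirring.fermi α 0 x φ)
          x Thirring.dirV ∧
        HasLineDerivAt ℝ (fun y => Thirring.fermi α 1 y φ)
          (-Complex.I * (α - Real.pi / α) * Thirring.dPhi 0 x φ * Thirring.fermi α 1 x φ)
          x Thirring.dirU) ∧
      ∃ N j : Fin 2 → Thirring.Spacetime → Thirring.Functional,
        (∀ a, Thirring.IsNormalDensity α a (N a)) ∧
        (∀ x, N 0 x = fun φ => -(α / (2 * Real.pi) + 1 / (2 * α)) * Thirring.dPhi 0 x φ) ∧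
        (∀ x, N 1 x = fun φ => (α / (2 * Real.pi) + 1 / (2 * α)) * Thirring.dPhi 1 x φ) ∧
        (∃ Z : ℝ, 0 < Z ∧ ∀ a x, j a x = fun φ => Z * N a x φ) ∧
        (∀ a, Thirring.HasCharge (Thirring.diracCurrent j 0) (Thirring.fermi α a) (-1)) ∧
        (∀ x, j 0 x = fun φ => -(α / Real.pi) * Thirring.dPhi 0 x φ) ∧
        (∀ x, j 1 x = fun φ => (α / Real.pi) * Thirring.dPhi 1 x φ) ∧
        Thirring.SatisfiesThirring (Real.pi ^ 2 / α ^ 2 - Real.pi) (Thirring.fermi α) j) ∧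
    -- the sine-Gordon interaction is the fermionic mass term
    (∀ β : ℝ, 0 < β → ∃ N : Thirring.Spacetime → Thirring.Functional,
      Thirring.IsMassTerm (β / 2) N ∧
      ∀ x, Thirring.cosField β x = fun φ => Real.pi * N x φ) := by
  refine ⟨fun α hα a b => Thirring.anticommuteSpacelike_fermi hα a b, ⟨fun f g hf hg a b => ?_,
    fun φ hφ x => ?_⟩, fun α hα => ⟨fun φ hφ x => Thirring.hasLineDerivAt_fermi α hφ x, ?_⟩,
    fun β hβ => ?_⟩
  · exact ⟨Thirring.isAnticommutator_fermi_fermi hf hg a b,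
      Thirring.isAnticommutator_fermiAdj_fermiAdj hf hg a b,
      Thirring.isAnticommutator_fermiAdj_fermi hf hg a b⟩
  · have h := Thirring.hasLineDerivAt_fermi (Real.sqrt Real.pi) hφ x
    have h0 : (Real.sqrt Real.pi : ℂ) - Real.pi / Real.sqrt Real.pi = 0 := by
      rw [← Complex.ofReal_div, Real.div_sqrt, sub_self]
    simpa only [h0, mul_zero, zero_mul] using h
  · refine ⟨Thirring.normalDensity α, Thirring.current α,
      fun a => Thirring.isNormalDensity_normalDensity hα a, fun x => rfl, fun x => rfl,
      Thirring.exists_current_eq_normalDensity hα, fun a => Thirring.hasCharge_fermi hα a,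
      fun x => rfl, fun x => rfl, Thirring.satisfiesThirring_fermi hα⟩
  · refine ⟨_, Thirring.isMassTerm_cosField (half_pos hβ), fun x => funext fun φ => ?_⟩
    rw [mul_div_cancel₀ β two_ne_zero, mul_inv_cancel_left₀ (by simp [Real.pi_ne_zero])]
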